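/- Consider a dual-hop amplify-and-forward link: a single-antenna source (distance $d_1$), a relay with $N\ge 1$ antennas, a single-antenna destination (distance $d_2$ from the relay) and one co-channel interferer at distance $d_I$ from the relay, with path loss exponent $\tau$. The entries of the channel vectors $\mathbf h_1,\mathbf h_I$ ($N\times1$) and $\mathbf h_2$ ($1\times N$) are independent $\mathcal{CN}(0,1)$. The source and interferer powers divided by the noise power are $\rho_1>0$ and $\rho_I>0$, and symbols and white noises are independent and centred. With power splitting ratio $\theta\in(0,1)$ and conversion efficiency $\eta>0$, the relay receives (noise normalised) $\mathbf y_r=\sqrt{(1-\theta)\rho_1/d_1^\tau}\,\mathbf h_1x+\sqrt{(1-\theta)\rho_I/d_I^\tau}\,\mathbf h_Is_I+\mathbf n_r$ and sends $\mathbf W\mathbf y_r$, where $\mathbf W=\omega\frac{\mathbf h_2^\dagger}{\|\mathbf h_2\|}\mathbf w_1$ and $\omega\ge0$ is such that the transmit power $E\|\mathbf W\mathbf y_r\|^2$ (given the channels) equals the harvested power $\eta\theta\big(\frac{\rho_1}{d_1^\tau}\|\mathbf h_1\|^2+\frac{\rho_I}{d_I^\tau}\|\mathbf h_I\|^2\big)$;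 the destination receives $d_2^{-\tau/2}\mathbf h_2\mathbf W\mathbf y_r$ plus noise. The MMSE/MRT scheme uses $\mathbf w_1=\mathbf h_1^\dagger\big(\mathbf h_1\mathbf h_1^\dagger+\mathbf h_I\mathbf h_I^\dagger+\frac{d_I^\tau}{(1-\theta)\rho_I}\mathbf I\big)^{-1}$, the MRC/MRT scheme $\mathbf w_1=\mathbf h_1^\dagger/\|\mathbf h_1\|$. Let $P^{\mathsf{MMSE}}(\rho_1)$ and $P^{\mathsf{MRC}}(\rho_1)$ be the probabilities that the end-to-end signal-to-interference-and-noise ratio at the destination is below the threshold $\gamma_{\rm th}>0$. For $a\in\mathbb R$ put $$A_a(\rho_1)=\Big(\frac{d_1^\tau\gamma_{\rm th}}{\rho_1}\Big)^N\Bigg(\frac{a}{(1-\theta)^N}+\frac{\big(\frac{d_2^\tau}{\eta\theta}\big)^N}{\Gamma(N+1)\Gamma(N)}\sum_{i=0}^{N-1}\binom{N-1}{i}(-1)^{N-i-1}\frac{{}_2F_1\big(N,2N-i-1;2N-i;1-\frac{d_1^\tau\rho_I}{d_I^\tau\rho_1}\big)}{2N-i-1}\Bigg),$$ $$a_{\mathsf{MMSE}}=\frac1{N!}+\frac{(1-\theta)\rho_I}{d_I^\tau\,\Gamma(N)},\qquad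 a_{\mathsf{MRC}}=\sum_{n=0}^N\frac{((1-\theta)\rho_I)^n}{d_I^{n\tau}(N-n)!}.$$ Then, as $\rho_1\to\infty$ with all other parameters fixed, $P^{\mathsf{MMSE}}(\rho_1)\sim A_{a_{\mathsf{MMSE}}}(\rho_1)$ (the ratio tends to $1$), and the diversity order is $N$: $-\log P^{\mathsf{MMSE}}(\rho_1)/\log\rho_1\to N$. Likewise $P^{\mathsf{MRC}}(\rho_1)\sim A_{a_{\mathsf{MRC}}}(\rho_1)$, and $a_{\mathsf{MMSE}}\le a_{\mathsf{MRC}}$. If $N\ge2$, then $a_{\mathsf{MMSE}}<a_{\mathsf{MRC}}$ (a better array gain of the MMSE/MRT scheme), and $P^{\mathsf{MMSE}}(\rho_1)<P^{\mathsf{MRC}}(\rho_1)$ for every $\rho_1>0$. -/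

import Mathlib

open Filter Topology MeasureTheory ProbabilityTheory Asymptotics
open scoped NNReal Matrix

/-- The standard circularly symmetric complex Gaussian law `CN(0,1)`: real and imaginary part
are independent, each normal with mean `0` and variance `1/2`. -/
noncomputable def stdComplexGaussian : Measure ℂ :=
  ((gaussianReal 0 (1 / 2 : ℝ≥0)).prod (gaussianReal 0 (1 / 2 : ℝ≥0))).map
    Complex.measurableEquivRealProd.symm

/-- Rayleigh fading: all the entries of the source-relay channel `h₁`, of the interferer-relay
channel `hI` and of the relay-destination channel `h₂` are independent `CN(0,1)` variables. -/
structure IsRayleighFading {Ω : Type*} [MeasurableSpace Ω] (P : Measure Ω) {N : ℕ}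
    (h₁ hI h₂ : Ω → Fin N → ℂ) : Prop where
  law₁ : ∀ i, HasLaw (fun ω => h₁ ω i) stdComplexGaussian P
  lawI : ∀ i, HasLaw (fun ω => hI ω i) stdComplexGaussian P
  law₂ : ∀ i, HasLaw (fun ω => h₂ ω i) stdComplexGaussian P
  indep : iIndepFun
    (Sum.elim (fun i ω => h₁ ω i) (Sum.elim (fun i ω => hI ω i) (fun i ω => h₂ ω i)) :
      Fin N ⊕ Fin N ⊕ Fin N → Ω → ℂ) P

/-- The fixed real parameters of the relay system: power splitting ratio `θ`, energy conversion
efficiency `η`, path loss exponent `τ`, distances source-relay `d₁`, relay-destination `d₂`,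
interferer-relay `dI`, interference-to-noise ratio `ρI`, outage threshold `γth`. -/
structure RelayParams where
  θ : ℝ
  η : ℝ
  τ : ℝ
  d₁ : ℝ
  d₂ : ℝ
  dI : ℝ
  ρI : ℝ
  γth : ℝ

/-- The natural ranges of the parameters. -/
structure RelayParams.Admissible (p : RelayParams) : Prop where
  θ_pos : 0 < p.θ
  θ_lt_one : p.θ < 1
  η_pos : 0 < p.η
  d₁_pos : 0 < p.d₁
  d₂_pos : 0 < p.d₂
  dI_pos : 0 < p.dI
  ρI_pos : 0 < p.ρI
  γth_pos : 0 < p.γth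

section Model

variable {N : ℕ}

/-- The squared Euclidean (Frobenius) norm of a complex vector. -/
noncomputable def sqNorm (v : Fin N → ℂ) : ℝ := ∑ i, ‖v i‖ ^ 2

/-- The power harvested at the relay, divided by the noise power `N₀`; `ρ₁ = Pₛ / N₀`. -/
noncomputable def harvestedPower (p : RelayParams) (ρ₁ : ℝ) (h₁ hI : Fin N → ℂ) : ℝ :=
  p.η * p.θ * (ρ₁ / p.d₁ ^ p.τ * sqNorm h₁ + p.ρI / p.dI ^ p.τ * sqNorm hI)

/-- The transmit power `E ‖V yᵣ‖²` divided by `N₀` of a relay that applies the matrix `V` to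
`yᵣ = √((1-θ) Pₛ / d₁^τ) h₁ x + √((1-θ) P_I / d_I^τ) h_I s_I + nᵣ`; the expectation is over the
independent centred unit power symbols `x`, `s_I` and the white noise `nᵣ` of power `N₀`, the
channels being given. -/
noncomputable def transmitPower (p : RelayParams) (ρ₁ : ℝ) (h₁ hI : Fin N → ℂ)
    (V : Matrix (Fin N) (Fin N) ℂ) : ℝ :=
  (1 - p.θ) * ρ₁ / p.d₁ ^ p.τ * sqNorm (V *ᵥ h₁)
    + (1 - p.θ) * p.ρI / p.dI ^ p.τ * sqNorm (V *ᵥ hI)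
    + ∑ i, ∑ j, ‖V i j‖ ^ 2

/-- The relay matrix `W = ω (h₂† / ‖h₂‖) w`: linear combining with the row vector `w`, then maximal
ratio transmission, where `ω ≥ 0` makes the transmit power equal to the harvested power. -/
noncomputable def relayMatrix (p : RelayParams) (ρ₁ : ℝ) (w h₁ hI h₂ : Fin N → ℂ) :
    Matrix (Fin N) (Fin N) ℂ :=
  let V : Matrix (Fin N) (Fin N) ℂ :=
    Matrix.vecMulVec (((√(sqNorm h₂) : ℝ) : ℂ)⁻¹ • star h₂) w
  ((√(harvestedPower p ρ₁ h₁ hI / transmitPower p ρ₁ h₁ hI V) : ℝ) : ℂ) • V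

/-- The end-to-end signal-to-interference-and-noise ratio at the destination, which receives
`√(1 / d₂^τ) h₂ W yᵣ + n_d`, when the relay applies the matrix `W`. -/
noncomputable def endToEndSINR (p : RelayParams) (ρ₁ : ℝ) (h₁ hI h₂ : Fin N → ℂ)
    (W : Matrix (Fin N) (Fin N) ℂ) : ℝ :=
  ((1 - p.θ) * ρ₁ / (p.d₁ ^ p.τ * p.d₂ ^ p.τ) * ‖h₂ ⬝ᵥ (W *ᵥ h₁)‖ ^ 2) /
    ((1 - p.θ) * p.ρI / (p.dI ^ p.τ * p.d₂ ^ p.τ) * ‖h₂ ⬝ᵥ (W *ᵥ hI)‖ ^ 2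
      + sqNorm (h₂ ᵥ* W) / p.d₂ ^ p.τ + 1)

/-- The maximum ratio combining vector `h₁† / ‖h₁‖`. -/
noncomputable def mrcCombiner (h₁ : Fin N → ℂ) : Fin N → ℂ :=
  ((√(sqNorm h₁) : ℝ) : ℂ)⁻¹ • star h₁

/-- The minimum mean-square error combining vector
`h₁† (h₁ h₁† + h_I h_I† + d_I^τ / ((1-θ) ρ_I) I)⁻¹`. -/
noncomputable def mmseCombiner (p : RelayParams) (h₁ hI : Fin N → ℂ) : Fin N → ℂ :=
  star h₁ ᵥ* (Matrix.vecMulVec h₁ (star h₁) + Matrix.vecMulVec hI (star hI)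
    + ((p.dI ^ p.τ / ((1 - p.θ) * p.ρI) : ℝ) : ℂ) • (1 : Matrix (Fin N) (Fin N) ℂ))⁻¹

/-- The SINR of the MRC/MRT scheme. -/
noncomputable def mrcSINR (p : RelayParams) (ρ₁ : ℝ) (h₁ hI h₂ : Fin N → ℂ) : ℝ :=
  endToEndSINR p ρ₁ h₁ hI h₂ (relayMatrix p ρ₁ (mrcCombiner h₁) h₁ hI h₂)

/-- The SINR of the MMSE/MRT scheme. -/
noncomputable def mmseSINR (p : RelayParams) (ρ₁ : ℝ) (h₁ hI h₂ : Fin N → ℂ) : ℝ :=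
  endToEndSINR p ρ₁ h₁ hI h₂ (relayMatrix p ρ₁ (mmseCombiner p h₁ hI) h₁ hI h₂)

variable {Ω : Type*} [MeasurableSpace Ω]

/-- The outage probability of the MRC/MRT scheme at the source signal-to-noise ratio `ρ₁`. -/
noncomputable def mrcOutage (P : Measure Ω) (p : RelayParams) (h₁ hI h₂ : Ω → Fin N → ℂ)
    (ρ₁ : ℝ) : ℝ :=
  P.real {ω | mrcSINR p ρ₁ (h₁ ω) (hI ω) (h₂ ω) < p.γth}

/-- The outage probability of the MMSE/MRT scheme at the source signal-to-noise ratio `ρ₁`. -/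
noncomputable def mmseOutage (P : Measure Ω) (p : RelayParams) (h₁ hI h₂ : Ω → Fin N → ℂ)
    (ρ₁ : ℝ) : ℝ :=
  P.real {ω | mmseSINR p ρ₁ (h₁ ω) (hI ω) (h₂ ω) < p.γth}

end Model

/-- The array gain coefficient `a_MMSE` of the MMSE/MRT scheme with `N` antennas. -/
noncomputable def mmseCoeff (p : RelayParams) (N : ℕ) : ℝ :=
  1 / (N.factorial : ℝ) + (1 - p.θ) * p.ρI / (p.dI ^ p.τ * Real.Gamma N)

/-- The array gain coefficient `a_MRC` of the MRC/MRT scheme with `N` antennas. -/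
noncomputable def mrcCoeff (p : RelayParams) (N : ℕ) : ℝ :=
  ∑ n ∈ Finset.range (N + 1),
    ((1 - p.θ) * p.ρI) ^ n / ((p.dI ^ p.τ) ^ n * ((N - n).factorial : ℝ))

/-- The high-SNR expression with first-hop coefficient `a`. For large `ρ₁` the argument of the
hypergeometric function lies in `(0, 1)`, where its power series converges. -/
noncomputable def highSNRApprox (p : RelayParams) (N : ℕ) (a : ℝ) (ρ₁ : ℝ) : ℝ :=
  (p.d₁ ^ p.τ * p.γth / ρ₁) ^ N *
    (a * (1 / (1 - p.θ) ^ N)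
      + (p.d₂ ^ p.τ / (p.η * p.θ)) ^ N / (Real.Gamma (N + 1) * Real.Gamma N) *
        ∑ i ∈ Finset.range N, ((N - 1).choose i : ℝ) * (-1) ^ (N - i - 1) *
          (₂F₁ (N : ℝ) (2 * N - i - 1 : ℝ) (2 * N - i : ℝ)
              (1 - p.d₁ ^ p.τ * p.ρI / (p.dI ^ p.τ * ρ₁))
            / (2 * N - i - 1 : ℝ)))

/-! Both outage probabilities and both high-SNR expressions, multiplied by `ρ ^ N / log ρ`, tend to
the same positive constant `outageConstant`. Equivalence and diversity order follow from this. The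
logarithm is decisive: the first-hop coefficient contributes only at order `ρ ^ (-N)`, so it does
not affect the leading term, and one limit serves MMSE and MRC alike.

On the probabilistic side, the power constraint turns the end-to-end ratio into `x y / (x + y + 1)`,
with `x` the first-hop ratio and `y` the second-hop ratio (`endToEndSINR_relayMatrix`). The squared
norms of the channels are independent gamma variables of shape `N`
(`map_sqNorm_pi_stdComplexGaussian`). By Cauchy-Schwarz `x` is at least of order `ρ ‖h₁‖² / (b ‖hI‖²
+ 1)` in both schemes, so it stays bounded only with probability `O(ρ ^ (-N))`. Otherwise outage
essentially means `‖h₁‖² ‖h₂‖² < c / ρ`, because the harvested interferer power is negligible beside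
the source power. A product of two independent gamma variables lies below `δ` with probability
asymptotic to `δ ^ N log (1 / δ) / (Γ(N) Γ(N + 1))`, which supplies the logarithm
(`tendsto_gammaProdCDF_mul_pow_div_log`, `HasGammaTripleLaw.tendsto_outage`).

On the analytic side, the alternating sum of hypergeometric functions has power series coefficients
`1 / n + O(1 / n²)`. It therefore differs from `-log (1 - z)` by a bounded amount near `z = 1`, and
at `z = 1 - κ / ρ` it grows like `log ρ` (`tendsto_hypergeometricSum_div_log`).

The strict comparison for fixed `ρ₁` is separate. The MMSE ratio dominates the MRC ratio pointwise,
and for `N ≥ 2` a nonempty open set of channels puts only MRC in outage. The Gaussian law charges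
every such set. -/

/-! ### Laws of the channels and of their squared norms -/

instance : IsProbabilityMeasure stdComplexGaussian := by
  unfold stdComplexGaussian
  exact Measure.isProbabilityMeasure_map (by fun_prop)

instance : stdComplexGaussian.IsOpenPosMeasure := by
  unfold stdComplexGaussian
  have h : (gaussianReal 0 (1 / 2 : ℝ≥0)).IsOpenPosMeasure :=
    (gaussianReal_absolutelyContinuous' 0 (by norm_num)).isOpenPosMeasure
  have := Complex.equivRealProdCLM.symm.continuous
  exact this.isOpenPosMeasure_map Complex.equivRealProdCLM.symm.surjective

lemma sqNorm_nonneg {N : ℕ} (v : Fin N → ℂ) : 0 ≤ sqNorm v := by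
  unfold sqNorm; positivity

lemma measurable_sqNorm {N : ℕ} : Measurable (sqNorm : (Fin N → ℂ) → ℝ) := by
  unfold sqNorm; fun_prop

lemma continuous_sqNorm {N : ℕ} : Continuous (sqNorm : (Fin N → ℂ) → ℝ) := by
  unfold sqNorm; fun_prop

lemma one_sub_mul_I_ne_zero (t : ℝ) : (1 - t * Complex.I : ℂ) ≠ 0 := by
  intro h
  have := congrArg Complex.re h
  simp at this

lemma integral_cexp_mul_sq_gaussianReal (t : ℝ) :
    ∫ x, Complex.exp ((x : ℂ) ^ 2 * (t * Complex.I)) ∂(gaussianReal 0 (1 / 2 : ℝ≥0))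
      = (√Real.pi : ℂ)⁻¹ * (Real.pi / (1 - t * Complex.I)) ^ (1 / 2 : ℂ) := by
  rw [integral_gaussianReal_eq_integral_smul (by norm_num), ← integral_gaussian_complex (by simp),
    ← integral_const_mul]
  congr 1 with x
  simp only [gaussianPDFReal, Complex.real_smul, sub_zero, NNReal.coe_div, NNReal.coe_one,
    NNReal.coe_ofNat]
  push_cast
  rw [mul_assoc, ← Complex.exp_add]
  congr 2
  · ring_nf
  · ring_nf

/-- Real and imaginary parts each contribute a factor with a complex square root. The two factors
are equal, so their product is free of any choice of branch: it is the characteristic function of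
the exponential law. -/
lemma integral_cexp_mul_norm_sq_stdComplexGaussian (t : ℝ) :
    ∫ z, Complex.exp ((‖z‖ : ℂ) ^ 2 * (t * Complex.I)) ∂stdComplexGaussian
      = (1 - t * Complex.I)⁻¹ := by
  unfold stdComplexGaussian
  rw [integral_map_equiv]
  have h (x : ℝ × ℝ) : Complex.exp ((‖Complex.measurableEquivRealProd.symm x‖ : ℂ) ^ 2 *
      (t * Complex.I)) = Complex.exp ((x.1 : ℂ) ^ 2 * (t * Complex.I)) *
        Complex.exp ((x.2 : ℂ) ^ 2 * (t * Complex.I)) := by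
    rw [← Complex.exp_add, ← add_mul, ← Complex.ofReal_pow, Complex.sq_norm]
    simp [Complex.measurableEquivRealProd, Complex.normSq_apply, pow_two]
  simp_rw [h]
  rw [integral_prod_mul (fun x : ℝ => Complex.exp ((x : ℂ) ^ 2 * (t * Complex.I)))
    (fun x : ℝ => Complex.exp ((x : ℂ) ^ 2 * (t * Complex.I)))]
  rw [integral_cexp_mul_sq_gaussianReal]
  have h2 : ((Real.pi / (1 - t * Complex.I) : ℂ) ^ (1 / 2 : ℂ)) ^ 2
      = Real.pi / (1 - t * Complex.I) := by
    rw [← Complex.cpow_nat_mul]; norm_num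
  have h3 : ((√Real.pi : ℂ)) ^ 2 = Real.pi := by
    rw [← Complex.ofReal_pow, Real.sq_sqrt Real.pi_pos.le]
  have h4 : (Real.pi : ℂ) ≠ 0 := by exact_mod_cast Real.pi_ne_zero
  calc _ = ((√Real.pi : ℂ) ^ 2)⁻¹ * ((Real.pi / (1 - t * Complex.I) : ℂ) ^ (1 / 2 : ℂ)) ^ 2 := by
        rw [← inv_pow]; ring
    _ = _ := by rw [h2, h3]; field_simp [one_sub_mul_I_ne_zero]

lemma lintegral_gammaMeasure_natCast {N : ℕ} (f : ℝ → ENNReal) (hf : Measurable f) :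
    ∫⁻ s, f s ∂gammaMeasure N 1
      = ∫⁻ s in Set.Ioi 0, ENNReal.ofReal (s ^ ((N : ℝ) - 1) * Real.exp (-s) / Real.Gamma N) * f s := by
  rw [gammaMeasure, lintegral_withDensity_eq_lintegral_mul _ (by unfold gammaPDF; fun_prop) hf,
    ← lintegral_add_compl _ (measurableSet_Iio (a := (0 : ℝ))), Set.compl_Iio,
    setLIntegral_congr (Ioi_ae_eq_Ici (a := (0 : ℝ))).symm]
  rw [setLIntegral_congr_fun (g := fun _ => 0) measurableSet_Iio, lintegral_zero, zero_add]
  · refine setLIntegral_congr_fun measurableSet_Ioi fun s (hs : 0 < s) => ?_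
    simp only [Pi.mul_apply]
    rw [gammaPDF_of_nonneg hs.le]
    congr 2
    simp; ring
  · intro s (hs : s < 0)
    simp [gammaPDF_of_neg hs]

lemma norm_cexp_neg_one_sub_mul_I (t s : ℝ) :
    ‖Complex.exp (-(1 - t * Complex.I) * s)‖ = Real.exp (-s) := by
  rw [Complex.norm_exp]; congr 1; simp

lemma integrableOn_pow_mul_cexp (n : ℕ) (t : ℝ) :
    IntegrableOn (fun s : ℝ => (s : ℂ) ^ n * Complex.exp (-(1 - t * Complex.I) * s))
      (Set.Ioi 0) := by
  have h := Real.GammaIntegral_convergent (s := n + 1) (by positivity)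
  refine Integrable.mono' h (by fun_prop) ?_
  refine (ae_restrict_iff' measurableSet_Ioi).mpr (ae_of_all _ fun s (hs : 0 < s) => ?_)
  rw [norm_mul, norm_cexp_neg_one_sub_mul_I, norm_pow, Complex.norm_real, Real.norm_of_nonneg hs.le]
  simp [mul_comm]

lemma tendsto_pow_mul_cexp (n : ℕ) (t : ℝ) :
    Tendsto (fun s : ℝ => (s : ℂ) ^ n * Complex.exp (-(1 - t * Complex.I) * s)) atTop (𝓝 0) := by
  rw [tendsto_zero_iff_norm_tendsto_zero]
  refine (Real.tendsto_pow_mul_exp_neg_atTop_nhds_zero n).congr' ?_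
  filter_upwards [eventually_ge_atTop 0] with s hs
  rw [norm_mul, norm_cexp_neg_one_sub_mul_I, norm_pow, Complex.norm_real, Real.norm_of_nonneg hs]

/-- Integration by parts, by induction on `n`: the derivative of `s ^ (n + 1) exp (-r s)` has
integral zero over the half-line, which links consecutive powers. -/
lemma integral_pow_mul_cexp (n : ℕ) (t : ℝ) :
    ∫ s in Set.Ioi (0 : ℝ), (s : ℂ) ^ n * Complex.exp (-(1 - t * Complex.I) * s)
      = n.factorial * ((1 - t * Complex.I)⁻¹) ^ (n + 1) := by
  have hr := one_sub_mul_I_ne_zero t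
  induction n with
  | zero =>
    have := integral_exp_mul_complex_Ioi (a := -(1 - t * Complex.I)) (by simp) 0
    simp only [pow_zero, one_mul, this]
    rw [Complex.ofReal_zero, mul_zero, Complex.exp_zero, neg_div_neg_eq]
    simp
  | succ n ih =>
    have hd (s : ℝ) : HasDerivAt (fun s : ℝ => (s : ℂ) ^ (n + 1) *
        Complex.exp (-(1 - t * Complex.I) * s))
        ((n + 1) * ((s : ℂ) ^ n * Complex.exp (-(1 - t * Complex.I) * s))
          - (1 - t * Complex.I) *
            ((s : ℂ) ^ (n + 1) * Complex.exp (-(1 - t * Complex.I) * s))) s := by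
      have h1 : HasDerivAt (fun z : ℂ => z ^ (n + 1) *
          Complex.exp (-(1 - t * Complex.I) * z))
          (((n + 1 : ℕ) * (s : ℂ) ^ n) * Complex.exp (-(1 - t * Complex.I) * s)
            + (s : ℂ) ^ (n + 1) * (Complex.exp (-(1 - t * Complex.I) * s)
              * (-(1 - t * Complex.I) * 1))) (s : ℂ) :=
        (hasDerivAt_pow (n + 1) (s : ℂ)).mul
          (((hasDerivAt_id (s : ℂ)).const_mul (-(1 - t * Complex.I))).cexp)
      convert! h1.comp_ofReal using 1
      push_cast; ring
    have h := integral_Ioi_of_hasDerivAt_of_tendsto' (a := (0 : ℝ)) (fun s _ => hd s)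
      (((integrableOn_pow_mul_cexp n t).const_mul _).sub
        ((integrableOn_pow_mul_cexp (n + 1) t).const_mul _)) (tendsto_pow_mul_cexp (n + 1) t)
    rw [integral_sub ((integrableOn_pow_mul_cexp n t).const_mul _)
        ((integrableOn_pow_mul_cexp (n + 1) t).const_mul _), integral_const_mul,
      integral_const_mul, ih] at h
    simp only [Complex.ofReal_zero, ne_eq, Nat.succ_ne_zero, not_false_eq_true, zero_pow,
      zero_mul, sub_zero, sub_eq_zero] at h
    refine mul_left_cancel₀ hr (h.symm.trans ?_)
    rw [Nat.factorial_succ, pow_succ _ (n + 1)]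
    push_cast
    field_simp

lemma charFun_gammaMeasure_natCast {N : ℕ} (hN : 0 < N) (t : ℝ) :
    charFun (gammaMeasure N 1) t = ((1 - t * Complex.I)⁻¹) ^ N := by
  obtain ⟨n, rfl⟩ := Nat.exists_eq_add_one.mpr hN
  rw [charFun_apply_real, gammaMeasure, integral_withDensity_eq_integral_toReal_smul
    (by unfold gammaPDF; fun_prop) (by simp [gammaPDF]),
    ← setIntegral_eq_integral_of_forall_compl_eq_zero (s := Set.Ici (0 : ℝ)),
    integral_Ici_eq_integral_Ioi]
  · have h : (n.factorial : ℂ) ≠ 0 := by exact_mod_cast n.factorial_ne_zero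
    refine mul_left_cancel₀ h ?_
    rw [← integral_pow_mul_cexp, ← integral_const_mul]
    refine setIntegral_congr_fun measurableSet_Ioi fun s (hs : 0 < s) => ?_
    have h2 : Complex.exp (-(1 - t * Complex.I) * s) =
        Complex.exp (-s) * Complex.exp (t * s * Complex.I) := by
      rw [← Complex.exp_add]; ring_nf
    have h3 := Real.Gamma_nat_eq_factorial n
    simp only [h2]
    rw [gammaPDF_of_nonneg hs.le, ENNReal.toReal_ofReal (by push_cast; rw [h3]; positivity)]
    push_cast
    simp only [h3]
    simp
    field_simp
  · intro s hs
    rw [gammaPDF_of_neg (by simpa using hs)]; simp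

/-- A finite measure is determined by its characteristic function, and that of a sum of `N`
independent exponential variables is the `N`-th power of one factor. -/
lemma map_sqNorm_pi_stdComplexGaussian {N : ℕ} (hN : 0 < N) :
    (Measure.pi fun _ : Fin N => stdComplexGaussian).map sqNorm = gammaMeasure N 1 := by
  have : IsProbabilityMeasure (gammaMeasure N 1) :=
    isProbabilityMeasure_gammaMeasure (by exact_mod_cast hN) one_pos
  have : IsProbabilityMeasure
      ((Measure.pi fun _ : Fin N => stdComplexGaussian).map sqNorm) :=
    Measure.isProbabilityMeasure_map measurable_sqNorm.aemeasurable
  refine Measure.ext_of_charFun (funext fun t => ?_)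
  rw [charFun_gammaMeasure_natCast hN, charFun_apply_real,
    integral_map measurable_sqNorm.aemeasurable (by fun_prop)]
  have h (v : Fin N → ℂ) : Complex.exp (t * (sqNorm v : ℂ) * Complex.I) =
      ∏ i, Complex.exp ((‖v i‖ : ℂ) ^ 2 * (t * Complex.I)) := by
    rw [← Complex.exp_sum, ← Finset.sum_mul]
    congr 1
    simp [sqNorm]; ring
  simp_rw [h]
  rw [integral_fintype_prod_eq_pow
    (fun z : ℂ => Complex.exp ((‖z‖ : ℂ) ^ 2 * (t * Complex.I)))]
  simp [integral_cexp_mul_norm_sq_stdComplexGaussian]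

/-- The joint law of the three channel vectors. -/
lemma IsRayleighFading.hasLaw {Ω : Type*} [MeasurableSpace Ω] {P : Measure Ω}
    [IsProbabilityMeasure P] {N : ℕ}
    {h₁ hI h₂ : Ω → Fin N → ℂ} (h : IsRayleighFading P h₁ hI h₂) :
    HasLaw (fun ω => (h₁ ω, hI ω, h₂ ω))
      ((Measure.pi fun _ : Fin N => stdComplexGaussian).prod
        ((Measure.pi fun _ : Fin N => stdComplexGaussian).prod
          (Measure.pi fun _ : Fin N => stdComplexGaussian))) P := by
  have h1 := h.indep.hasLaw_pi (μ := fun _ => stdComplexGaussian) (by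
    rintro (i | i | i)
    · exact h.law₁ i
    · exact h.lawI i
    · exact h.law₂ i)
  have e1 := measurePreserving_sumPiEquivProdPi
    (fun _ : Fin N ⊕ Fin N ⊕ Fin N => stdComplexGaussian)
  have e2 := measurePreserving_sumPiEquivProdPi
    (fun _ : Fin N ⊕ Fin N => stdComplexGaussian)
  have e3 := (MeasurePreserving.id (Measure.pi fun _ : Fin N => stdComplexGaussian)).prod e2
  exact (e3.comp e1).comp_hasLaw h1

/-! ### Reduction of the end-to-end ratio to two hops -/

section Algebra
variable {N : ℕ}

lemma sqNorm_smul (c : ℂ) (v : Fin N → ℂ) : sqNorm (c • v) = ‖c‖ ^ 2 * sqNorm v := by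
  simp [sqNorm, mul_pow, Finset.mul_sum]

lemma sqNorm_star (v : Fin N → ℂ) : sqNorm (star v) = sqNorm v := by
  simp [sqNorm]

lemma dotProduct_star_self (v : Fin N → ℂ) : v ⬝ᵥ star v = (sqNorm v : ℂ) := by
  simp [dotProduct, sqNorm, Complex.mul_conj']

lemma star_dotProduct_self (v : Fin N → ℂ) : star v ⬝ᵥ v = (sqNorm v : ℂ) := by
  rw [dotProduct_comm, dotProduct_star_self]

lemma norm_star_dotProduct_sq_comm (v w : Fin N → ℂ) :
    ‖star v ⬝ᵥ w‖ ^ 2 = ‖star w ⬝ᵥ v‖ ^ 2 := by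
  have : star (star v ⬝ᵥ w) = star w ⬝ᵥ v := by
    rw [Matrix.star_dotProduct, star_star]
  rw [← this, norm_star]

lemma norm_star_dotProduct_sq_le (v w : Fin N → ℂ) :
    ‖star v ⬝ᵥ w‖ ^ 2 ≤ sqNorm v * sqNorm w := by
  have h := norm_inner_le_norm (𝕜 := ℂ) (WithLp.toLp 2 v) (WithLp.toLp 2 w)
  have h1 (u : Fin N → ℂ) : ‖WithLp.toLp 2 u‖ ^ 2 = sqNorm u := by
    rw [EuclideanSpace.norm_sq_eq]; rfl
  rw [← h1, ← h1, ← mul_pow]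
  have h2 : inner ℂ (WithLp.toLp 2 v) (WithLp.toLp 2 w) = star v ⬝ᵥ w := by
    rw [EuclideanSpace.inner_eq_star_dotProduct, dotProduct_comm]
  rw [h2] at h
  gcongr

lemma sqNorm_eq_zero {v : Fin N → ℂ} : sqNorm v = 0 ↔ v = 0 := by
  unfold sqNorm
  rw [Finset.sum_eq_zero_iff_of_nonneg (fun i _ => by positivity)]
  simp [funext_iff]

/-- The signal-to-interference-and-noise ratio of the first hop. -/
noncomputable def firstHopSINR (a b : ℝ) (w h₁ hI : Fin N → ℂ) : ℝ :=
  a * ‖w ⬝ᵥ h₁‖ ^ 2 / (b * ‖w ⬝ᵥ hI‖ ^ 2 + sqNorm w)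

/-- The signal-to-noise ratio of the second hop. -/
noncomputable def secondHopSNR (p : RelayParams) (ρ₁ : ℝ) (h₁ hI h₂ : Fin N → ℂ) : ℝ :=
  harvestedPower p ρ₁ h₁ hI * sqNorm h₂ / p.d₂ ^ p.τ

/-- The end-to-end ratio of a two-hop link with ratios `x` and `y` on its hops. -/
noncomputable def twoHopRatio (x y : ℝ) : ℝ := x * y / (x + y + 1)

/-- The relay matrix has rank one with a unit column factor, so before scaling its transmit power
`T` is the first-hop signal power plus `D`, the interference and noise power. Substituting the
squared gain `H / T` and clearing denominators gives the two-hop form. If `h₂ = 0` or `w = 0`, both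
sides vanish by the convention for division by zero. -/
lemma endToEndSINR_relayMatrix (p : RelayParams) (hp : p.Admissible) {ρ₁ : ℝ} (hρ : 0 < ρ₁)
    (w h₁ hI h₂ : Fin N → ℂ) :
    endToEndSINR p ρ₁ h₁ hI h₂ (relayMatrix p ρ₁ w h₁ hI h₂) =
      twoHopRatio (firstHopSINR ((1 - p.θ) * ρ₁ / p.d₁ ^ p.τ) ((1 - p.θ) * p.ρI / p.dI ^ p.τ)
        w h₁ hI) (secondHopSNR p ρ₁ h₁ hI h₂) := by
  have hd₁ : 0 < p.d₁ ^ p.τ := Real.rpow_pos_of_pos hp.d₁_pos _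
  have hd₂ : 0 < p.d₂ ^ p.τ := Real.rpow_pos_of_pos hp.d₂_pos _
  have hdI : 0 < p.dI ^ p.τ := Real.rpow_pos_of_pos hp.dI_pos _
  have hθ := sub_pos.mpr hp.θ_lt_one
  have hη := hp.η_pos
  have hθ0 := hp.θ_pos
  have hρI := hp.ρI_pos
  have hH : 0 ≤ harvestedPower p ρ₁ h₁ hI := by
    unfold harvestedPower
    have := sqNorm_nonneg h₁
    have := sqNorm_nonneg hI
    positivity
  set H := harvestedPower p ρ₁ h₁ hI with hHdef
  have hS := sqNorm_nonneg h₂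
  set c := ((√(sqNorm h₂) : ℝ) : ℂ)⁻¹ with hc
  have hcn : ‖c‖ ^ 2 = (sqNorm h₂)⁻¹ := by
    rw [hc, norm_inv, Complex.norm_real, Real.norm_of_nonneg (Real.sqrt_nonneg _), inv_pow,
      Real.sq_sqrt hS]
  by_cases hz : h₂ = 0
  · subst hz
    simp [endToEndSINR, twoHopRatio, secondHopSNR, sqNorm_eq_zero.mpr rfl]
  have hSpos : 0 < sqNorm h₂ := lt_of_le_of_ne hS (fun h => hz (sqNorm_eq_zero.mp h.symm))
  set T := transmitPower p ρ₁ h₁ hI (Matrix.vecMulVec (c • star h₂) w) with hT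
  have hmul (v : Fin N → ℂ) : Matrix.vecMulVec (c • star h₂) w *ᵥ v
      = (w ⬝ᵥ v) • (c • star h₂) := by
    rw [Matrix.vecMulVec_mulVec]; ext i; simp [mul_comm]
  have hunit : sqNorm (c • star h₂) = 1 := by
    rw [sqNorm_smul, sqNorm_star, hcn, inv_mul_cancel₀ hSpos.ne']
  have hTeq : T = (1 - p.θ) * ρ₁ / p.d₁ ^ p.τ * ‖w ⬝ᵥ h₁‖ ^ 2 +
      ((1 - p.θ) * p.ρI / p.dI ^ p.τ * ‖w ⬝ᵥ hI‖ ^ 2 + sqNorm w) := by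
    rw [hT, transmitPower, hmul, hmul, sqNorm_smul (w ⬝ᵥ h₁), sqNorm_smul (w ⬝ᵥ hI), hunit]
    have : ∑ i, ∑ j, ‖Matrix.vecMulVec (c • star h₂) w i j‖ ^ 2 = sqNorm w := by
      simp_rw [Matrix.vecMulVec_apply, norm_mul, mul_pow, ← Finset.mul_sum]
      rw [← Finset.sum_mul]
      change sqNorm (c • star h₂) * sqNorm w = _
      rw [hunit, one_mul]
    rw [this]; ring
  have hW : relayMatrix p ρ₁ w h₁ hI h₂ =
      ((√(H / T) : ℝ) : ℂ) • Matrix.vecMulVec (c • star h₂) w := rfl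
  rw [hW]
  by_cases hw : w = 0
  · subst hw
    simp [endToEndSINR, twoHopRatio, firstHopSINR]
  have hwpos : 0 < sqNorm w :=
    lt_of_le_of_ne (sqNorm_nonneg w) (fun h => hw (sqNorm_eq_zero.mp h.symm))
  have hTpos : 0 < T := by rw [hTeq]; positivity
  have hom : ‖((√(H / T) : ℝ) : ℂ)‖ ^ 2 = H / T := by
    rw [Complex.norm_real, Real.norm_of_nonneg (Real.sqrt_nonneg _), Real.sq_sqrt (by positivity)]
  have hcc : ‖h₂ ⬝ᵥ (c • star h₂)‖ ^ 2 = sqNorm h₂ := by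
    rw [dotProduct_smul, dotProduct_star_self, smul_eq_mul, norm_mul, mul_pow, hcn,
      Complex.norm_real, Real.norm_of_nonneg hS]
    field_simp
  have hdot (v : Fin N → ℂ) :
      ‖h₂ ⬝ᵥ ((((√(H / T) : ℝ) : ℂ) • Matrix.vecMulVec (c • star h₂) w) *ᵥ v)‖ ^ 2
        = H / T * (‖w ⬝ᵥ v‖ ^ 2 * sqNorm h₂) := by
    rw [Matrix.smul_mulVec, hmul, dotProduct_smul, dotProduct_smul, smul_eq_mul, smul_eq_mul,
      norm_mul, norm_mul, mul_pow, mul_pow, hom, hcc]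
  have hvec : sqNorm (h₂ ᵥ* (((√(H / T) : ℝ) : ℂ) • Matrix.vecMulVec (c • star h₂) w))
      = H / T * (sqNorm h₂ * sqNorm w) := by
    rw [Matrix.vecMul_smul, Matrix.vecMul_vecMulVec, sqNorm_smul, sqNorm_smul, hom, hcc]
  rw [endToEndSINR, hdot, hdot, hvec, twoHopRatio, secondHopSNR, firstHopSINR, ← hHdef]
  set A := ‖w ⬝ᵥ h₁‖ ^ 2
  set B := ‖w ⬝ᵥ hI‖ ^ 2
  set D := (1 - p.θ) * p.ρI / p.dI ^ p.τ * B + sqNorm w with hD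
  have hDpos : 0 < D := by positivity
  set a := (1 - p.θ) * ρ₁ / p.d₁ ^ p.τ with ha
  have hapos : 0 < a := by positivity
  set d := p.d₂ ^ p.τ
  set S := sqNorm h₂
  have e1 : (1 - p.θ) * ρ₁ / (p.d₁ ^ p.τ * d) * (H / T * (A * S)) = H / T * S / d * (a * A) := by
    rw [ha]; field_simp
  have e2 : (1 - p.θ) * p.ρI / (p.dI ^ p.τ * d) * (H / T * (B * S)) + H / T * (S * sqNorm w) / d
      = H / T * S / d * D := by
    rw [hD]; field_simp
  rw [e1, e2]
  have hA : 0 ≤ A := by positivity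
  rw [div_eq_div_iff (by positivity) (by positivity)]
  rw [hTeq]
  field_simp
  ring

/-- The first-hop ratio of the MRC combiner. -/
noncomputable def mrcRatio (a b : ℝ) (h₁ hI : Fin N → ℂ) : ℝ :=
  a * sqNorm h₁ ^ 2 / (b * ‖star hI ⬝ᵥ h₁‖ ^ 2 + sqNorm h₁)

/-- The first-hop ratio of the MMSE combiner. -/
noncomputable def mmseRatio (a b : ℝ) (h₁ hI : Fin N → ℂ) : ℝ :=
  a * (sqNorm h₁ - b * ‖star hI ⬝ᵥ h₁‖ ^ 2 / (1 + b * sqNorm hI))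

lemma firstHopSINR_smul (a b : ℝ) {k : ℂ} (hk : k ≠ 0) (w h₁ hI : Fin N → ℂ) :
    firstHopSINR a b (k • w) h₁ hI = firstHopSINR a b w h₁ hI := by
  have : ‖k‖ ^ 2 ≠ 0 := by simpa using hk
  rw [firstHopSINR, firstHopSINR, smul_dotProduct, smul_dotProduct, smul_eq_mul, smul_eq_mul,
    norm_mul, norm_mul, sqNorm_smul, mul_pow, mul_pow,
    ← mul_div_mul_left (a * ‖w ⬝ᵥ h₁‖ ^ 2) _ this]
  congr 1 <;> ring

lemma firstHopSINR_mrcCombiner (a b : ℝ) (h₁ hI : Fin N → ℂ) :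
    firstHopSINR a b (mrcCombiner h₁) h₁ hI = mrcRatio a b h₁ hI := by
  by_cases hz : h₁ = 0
  · subst hz; simp [firstHopSINR, mrcRatio, sqNorm_eq_zero.mpr rfl]
  have hS : 0 < sqNorm h₁ :=
    lt_of_le_of_ne (sqNorm_nonneg _) (fun h => hz (sqNorm_eq_zero.mp h.symm))
  rw [mrcCombiner, firstHopSINR_smul _ _ (by simpa using (Real.sqrt_pos.mpr hS).ne'),
    firstHopSINR, star_dotProduct_self, norm_star_dotProduct_sq_comm, sqNorm_star, mrcRatio,
    Complex.norm_real, Real.norm_of_nonneg hS.le]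

open scoped ComplexOrder in
lemma isUnit_det_add_smul_one {κ : ℝ} (hκ : 0 < κ) (h₁ hI : Fin N → ℂ) :
    IsUnit (Matrix.vecMulVec h₁ (star h₁) + Matrix.vecMulVec hI (star hI)
      + (κ : ℂ) • (1 : Matrix (Fin N) (Fin N) ℂ)).det := by
  rw [← Matrix.isUnit_iff_isUnit_det]
  refine Matrix.PosDef.isUnit ?_
  refine Matrix.PosDef.posSemidef_add
    ((Matrix.posSemidef_vecMulVec_self_star h₁).add (Matrix.posSemidef_vecMulVec_self_star hI)) ?_
  exact Matrix.PosDef.one.smul (by exact_mod_cast hκ)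

/-- The term `h₁ h₁†` only rescales the combiner. Writing `w M = h₁†` out shows that `κ w` is `(1 -
w h₁) h₁† - (w hI) hI†`, and pairing with `hI` determines `w hI` up to the factor `1 - w h₁`. -/
lemma exists_vecMul_inv_eq_smul {κ : ℝ} (hκ : 0 < κ) (h₁ hI : Fin N → ℂ) :
    ∃ k : ℂ, k ≠ 0 ∧ star h₁ ᵥ* (Matrix.vecMulVec h₁ (star h₁) + Matrix.vecMulVec hI (star hI)
      + (κ : ℂ) • (1 : Matrix (Fin N) (Fin N) ℂ))⁻¹ =
      k • (star h₁ - (star h₁ ⬝ᵥ hI / ((κ + sqNorm hI : ℝ) : ℂ)) • star hI) := by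
  have hdet := isUnit_det_add_smul_one hκ h₁ hI
  set M := Matrix.vecMulVec h₁ (star h₁) + Matrix.vecMulVec hI (star hI)
      + (κ : ℂ) • (1 : Matrix (Fin N) (Fin N) ℂ) with hM
  set w := star h₁ ᵥ* M⁻¹ with hw
  have hκ0 : (κ : ℂ) ≠ 0 := by exact_mod_cast hκ.ne'
  have hwM : w ᵥ* M = star h₁ := by
    rw [hw, Matrix.vecMul_vecMul, Matrix.nonsing_inv_mul _ hdet, Matrix.vecMul_one]
  have h0 : (w ⬝ᵥ h₁) • star h₁ + (w ⬝ᵥ hI) • star hI + (κ : ℂ) • w = star h₁ := by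
    refine Eq.trans ?_ hwM
    rw [hM, Matrix.vecMul_add, Matrix.vecMul_add, Matrix.vecMul_vecMulVec,
      Matrix.vecMul_vecMulVec, Matrix.vecMul_smul, Matrix.vecMul_one]
  have h1 : (w ⬝ᵥ h₁) * (star h₁ ⬝ᵥ hI) + (w ⬝ᵥ hI) * (sqNorm hI : ℂ) + κ * (w ⬝ᵥ hI)
      = star h₁ ⬝ᵥ hI := by
    have := congrArg (fun v => v ⬝ᵥ hI) h0
    simpa [add_dotProduct, smul_dotProduct, star_dotProduct_self] using this
  have h2 : (w ⬝ᵥ h₁) * (sqNorm h₁ : ℂ) + (w ⬝ᵥ hI) * (star hI ⬝ᵥ h₁) + κ * (w ⬝ᵥ h₁)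
      = (sqNorm h₁ : ℂ) := by
    have := congrArg (fun v => v ⬝ᵥ h₁) h0
    simpa [add_dotProduct, smul_dotProduct, star_dotProduct_self] using this
  set u := 1 - w ⬝ᵥ h₁ with hu
  have hden : ((κ + sqNorm hI : ℝ) : ℂ) ≠ 0 := by
    have : 0 < κ + sqNorm hI := by linarith [sqNorm_nonneg hI]
    exact_mod_cast this.ne'
  have hβ : w ⬝ᵥ hI = u * (star h₁ ⬝ᵥ hI / ((κ + sqNorm hI : ℝ) : ℂ)) := by
    rw [← mul_div_assoc, eq_div_iff hden, hu]
    push_cast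
    linear_combination h1
  refine ⟨u / κ, div_ne_zero (fun hu0 => ?_) hκ0, ?_⟩
  -- If the factor vanished, `w h₁ = 1` and `w hI = 0`, and pairing with `h₁` would force `κ = 0`.
  · have hα : w ⬝ᵥ h₁ = 1 := by linear_combination -hu + -hu0
    rw [hα, hβ, hu0] at h2
    refine hκ0 ?_
    linear_combination h2
  · have h3 : (κ : ℂ) • w = u • star h₁ - (w ⬝ᵥ hI) • star hI := by
      rw [hu]
      linear_combination (exp := 1) h0 + (sub_smul 1 (w ⬝ᵥ h₁) (star h₁)).symm
        + (one_smul ℂ (star h₁)).symm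
    rw [div_eq_inv_mul, mul_smul, smul_sub, smul_smul u, ← hβ, ← h3, smul_smul,
      inv_mul_cancel₀ hκ0, one_smul]

/-- For the whitening combiner the interference-plus-noise power equals the real amplitude `w h₁`
(this is `e4`), so the ratio collapses to `a (w h₁)`. When that amplitude is zero, `0 / 0 = 0` gives
the right value. -/
lemma firstHopSINR_whitened {b : ℝ} (hb : 0 < b) (a : ℝ) (h₁ hI : Fin N → ℂ) :
    firstHopSINR a b (star h₁ - (star h₁ ⬝ᵥ hI / ((b⁻¹ + sqNorm hI : ℝ) : ℂ)) • star hI) h₁ hI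
      = mmseRatio a b h₁ hI := by
  have hT := sqNorm_nonneg hI
  set D := b⁻¹ + sqNorm hI with hD
  have hDpos : 0 < D := by positivity
  have hDC : (D : ℂ) ≠ 0 := by exact_mod_cast hDpos.ne'
  set z := star hI ⬝ᵥ h₁ with hz
  have hzc : star h₁ ⬝ᵥ hI = (starRingEnd ℂ) z := by
    rw [hz, ← Complex.star_def, Matrix.star_dotProduct]
  rw [hzc]
  set X := ‖z‖ ^ 2 with hX
  have hXC : (starRingEnd ℂ) z * z = (X : ℂ) := by
    rw [Complex.conj_mul', hX]; push_cast; rfl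
  set w := star h₁ - ((starRingEnd ℂ) z / (D : ℂ)) • star hI with hw
  have e1 : w ⬝ᵥ h₁ = ((sqNorm h₁ - X / D : ℝ) : ℂ) := by
    rw [hw, sub_dotProduct, smul_dotProduct, star_dotProduct_self, ← hz, smul_eq_mul,
      div_mul_eq_mul_div, hXC]
    push_cast; rfl
  have e2 : w ⬝ᵥ hI = (starRingEnd ℂ) z * ((b⁻¹ / D : ℝ) : ℂ) := by
    rw [hw, sub_dotProduct, smul_dotProduct, star_dotProduct_self, hzc, smul_eq_mul]
    have : (b⁻¹ : ℝ) = D - sqNorm hI := by rw [hD]; ring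
    rw [this]
    push_cast
    field_simp
  have e3 : sqNorm w = sqNorm h₁ - X / D - X / D * (b⁻¹ / D) := by
    have h : w ⬝ᵥ star w = ((sqNorm h₁ - X / D - X / D * (b⁻¹ / D) : ℝ) : ℂ) := by
      have hs : star w = h₁ - (z / (D : ℂ)) • hI := by
        rw [hw, star_sub, star_smul, star_star, star_star]
        simp
      rw [hs, dotProduct_sub, dotProduct_smul, e1, e2, smul_eq_mul]
      push_cast
      rw [← hXC]
      field_simp
    rw [dotProduct_star_self] at h
    exact_mod_cast h
  rw [firstHopSINR, e1, e2, e3, mmseRatio, Complex.norm_real, norm_mul, RCLike.norm_conj,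
    Complex.norm_real, mul_pow, Real.norm_eq_abs, Real.norm_eq_abs, sq_abs, sq_abs, ← hX]
  have e4 : b * (X * (b⁻¹ / D) ^ 2) + (sqNorm h₁ - X / D - X / D * (b⁻¹ / D))
      = sqNorm h₁ - X / D := by
    field_simp
    ring
  have e5 : b * X / (1 + b * sqNorm hI) = X / D := by
    rw [hD]; field_simp
  rw [e4, e5]
  by_cases h0 : sqNorm h₁ - X / D = 0
  · rw [h0]; simp
  · field_simp

lemma firstHopSINR_mmseCombiner (p : RelayParams) (hp : p.Admissible) (a : ℝ)
    (h₁ hI : Fin N → ℂ) :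
    firstHopSINR a ((1 - p.θ) * p.ρI / p.dI ^ p.τ) (mmseCombiner p h₁ hI) h₁ hI =
      mmseRatio a ((1 - p.θ) * p.ρI / p.dI ^ p.τ) h₁ hI := by
  have hdI : 0 < p.dI ^ p.τ := Real.rpow_pos_of_pos hp.dI_pos _
  have hθ := sub_pos.mpr hp.θ_lt_one
  have hρI := hp.ρI_pos
  set b := (1 - p.θ) * p.ρI / p.dI ^ p.τ with hb
  have hbpos : 0 < b := by positivity
  have hκ : p.dI ^ p.τ / ((1 - p.θ) * p.ρI) = b⁻¹ := by rw [hb, inv_div]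
  obtain ⟨k, hk, hw⟩ : ∃ k : ℂ, k ≠ 0 ∧ mmseCombiner p h₁ hI =
      k • (star h₁ - (star h₁ ⬝ᵥ hI / ((b⁻¹ + sqNorm hI : ℝ) : ℂ)) • star hI) := by
    rw [mmseCombiner, hκ]
    exact exists_vecMul_inv_eq_smul (by positivity) h₁ hI
  rw [hw, firstHopSINR_smul _ _ hk]
  exact firstHopSINR_whitened hbpos a h₁ hI

lemma mrcSINR_eq (p : RelayParams) (hp : p.Admissible) {ρ₁ : ℝ} (hρ : 0 < ρ₁)
    (h₁ hI h₂ : Fin N → ℂ) : mrcSINR p ρ₁ h₁ hI h₂ =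
      twoHopRatio (mrcRatio ((1 - p.θ) * ρ₁ / p.d₁ ^ p.τ) ((1 - p.θ) * p.ρI / p.dI ^ p.τ)
        h₁ hI) (secondHopSNR p ρ₁ h₁ hI h₂) := by
  rw [mrcSINR, endToEndSINR_relayMatrix p hp hρ, firstHopSINR_mrcCombiner]

lemma mmseSINR_eq (p : RelayParams) (hp : p.Admissible) {ρ₁ : ℝ} (hρ : 0 < ρ₁)
    (h₁ hI h₂ : Fin N → ℂ) : mmseSINR p ρ₁ h₁ hI h₂ =
      twoHopRatio (mmseRatio ((1 - p.θ) * ρ₁ / p.d₁ ^ p.τ) ((1 - p.θ) * p.ρI / p.dI ^ p.τ)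
        h₁ hI) (secondHopSNR p ρ₁ h₁ hI h₂) := by
  rw [mmseSINR, endToEndSINR_relayMatrix p hp hρ, firstHopSINR_mmseCombiner p hp]

/-- The difference has the sign of `X (T S - X)`, where `X` is the squared inner product and `S`,
`T` are the squared norms, so Cauchy-Schwarz decides. Equality in Cauchy-Schwarz, and orthogonality,
make the ratios coincide. -/
lemma mrcRatio_le_mmseRatio {a b : ℝ} (ha : 0 ≤ a) (hb : 0 ≤ b) (h₁ hI : Fin N → ℂ) :
    mrcRatio a b h₁ hI ≤ mmseRatio a b h₁ hI := by
  have hX := norm_star_dotProduct_sq_le hI h₁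
  have hS := sqNorm_nonneg h₁
  have hSI := sqNorm_nonneg hI
  unfold mrcRatio mmseRatio
  rw [mul_div_assoc]
  refine mul_le_mul_of_nonneg_left ?_ ha
  have hX0 : 0 ≤ ‖star hI ⬝ᵥ h₁‖ ^ 2 := by positivity
  generalize ‖star hI ⬝ᵥ h₁‖ ^ 2 = X at *
  generalize sqNorm h₁ = S at *
  generalize sqNorm hI = T at *
  rcases hS.eq_or_lt with rfl | hS
  · have : X = 0 := by nlinarith
    simp [this]
  have e : S - b * X / (1 + b * T) - S ^ 2 / (b * X + S)
      = b ^ 2 * X * (T * S - X) / ((1 + b * T) * (b * X + S)) := by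
    field_simp; ring
  have : 0 ≤ b ^ 2 * X * (T * S - X) / ((1 + b * T) * (b * X + S)) :=
    div_nonneg (mul_nonneg (by positivity) (sub_nonneg.mpr hX)) (by positivity)
  linarith

/-- Cauchy-Schwarz removes the angle between `h₁` and `hI`, leaving a bound in the independent
squared norms. It is all the asymptotics need to know about the first hop. -/
lemma div_le_mrcRatio {a b : ℝ} (ha : 0 ≤ a) (hb : 0 ≤ b) (h₁ hI : Fin N → ℂ) :
    a * sqNorm h₁ / (b * sqNorm hI + 1) ≤ mrcRatio a b h₁ hI := by
  have hX := norm_star_dotProduct_sq_le hI h₁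
  have hS := sqNorm_nonneg h₁
  have hSI := sqNorm_nonneg hI
  unfold mrcRatio
  have hX0 : 0 ≤ ‖star hI ⬝ᵥ h₁‖ ^ 2 := by positivity
  rcases hS.eq_or_lt with h0 | h0
  · simp [← h0]
  rw [div_le_div_iff₀ (by positivity) (by positivity)]
  have : b * ‖star hI ⬝ᵥ h₁‖ ^ 2 ≤ b * (sqNorm hI * sqNorm h₁) := by gcongr
  nlinarith [mul_nonneg ha hS]

lemma secondHopSNR_nonneg (p : RelayParams) (hp : p.Admissible) {ρ₁ : ℝ} (hρ : 0 < ρ₁)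
    (h₁ hI h₂ : Fin N → ℂ) : 0 ≤ secondHopSNR p ρ₁ h₁ hI h₂ := by
  have hd₁ : 0 < p.d₁ ^ p.τ := Real.rpow_pos_of_pos hp.d₁_pos _
  have hd₂ : 0 < p.d₂ ^ p.τ := Real.rpow_pos_of_pos hp.d₂_pos _
  have hdI : 0 < p.dI ^ p.τ := Real.rpow_pos_of_pos hp.dI_pos _
  have hη := hp.η_pos
  have hθ0 := hp.θ_pos
  have hρI := hp.ρI_pos
  have := sqNorm_nonneg h₁
  have := sqNorm_nonneg hI
  have := sqNorm_nonneg h₂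
  unfold secondHopSNR harvestedPower
  positivity

lemma twoHopRatio_mono {x x' y : ℝ} (hx : 0 ≤ x) (hy : 0 ≤ y) (h : x ≤ x') :
    twoHopRatio x y ≤ twoHopRatio x' y := by
  unfold twoHopRatio
  rw [div_le_div_iff₀ (by linarith) (by linarith)]
  nlinarith [mul_nonneg (mul_nonneg (sub_nonneg.mpr h) hy) hy, mul_nonneg (sub_nonneg.mpr h) hy]

lemma twoHopRatio_le_left {x y : ℝ} (hx : 0 ≤ x) (hy : 0 ≤ y) : twoHopRatio x y ≤ x := by
  unfold twoHopRatio
  rw [div_le_iff₀ (by linarith)]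
  nlinarith

lemma twoHopRatio_le_right {x y : ℝ} (hx : 0 ≤ x) (hy : 0 ≤ y) : twoHopRatio x y ≤ y := by
  unfold twoHopRatio
  rw [div_le_iff₀ (by linarith)]
  nlinarith

/-- The hypothesis amounts to `(x - g) (y - g) < g ^ 2 + g`. The bound on `y` tends to `g` as `M`
grows. -/
lemma lt_of_twoHopRatio_lt {x y M g : ℝ} (hg : 0 < g) (hM : g < M) (hx : M ≤ x) (hy : 0 ≤ y)
    (h : twoHopRatio x y < g) : y < g + (g ^ 2 + g) / (M - g) := by
  unfold twoHopRatio at h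
  rw [div_lt_iff₀ (by linarith)] at h
  have hMg : 0 < M - g := by linarith
  have hyg : y - g < (g ^ 2 + g) / (M - g) := by
    rw [lt_div_iff₀ hMg]
    by_cases hc : y ≤ g
    · nlinarith
    · nlinarith
  linarith

end Algebra

/-! ### Logarithmic growth of the hypergeometric sum -/

section Hypergeometric

/-- A partial fraction expansion. By Pascal's rule, passing from `m` to `m + 1` takes the difference
of the values at `x` and `x + 1`. -/
lemma sum_choose_mul_neg_one_pow_div_add (m : ℕ) {x : ℝ} (hx : 0 < x) :
    ∑ k ∈ Finset.range (m + 1), (m.choose k : ℝ) * ((-1) ^ k / (x + k))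
      = m.factorial / (ascPochhammer ℝ (m + 1)).eval x := by
  induction m generalizing x with
  | zero => simp
  | succ n ih =>
    have h := Finset.sum_choose_succ_mul (R := ℝ) (fun i _ => (-1) ^ i / (x + i)) n
    have h2 : ∑ i ∈ Finset.range (n + 1), (n.choose i : ℝ) * ((-1) ^ (i + 1) / (x + (i + 1 : ℕ)))
        = -∑ i ∈ Finset.range (n + 1), (n.choose i : ℝ) * ((-1) ^ i / ((x + 1) + i)) := by
      rw [← Finset.sum_neg_distrib]
      refine Finset.sum_congr rfl fun i _ => ?_
      push_cast
      rw [pow_succ, show x + (i + 1 : ℝ) = x + 1 + i by ring]; ring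
    rw [h, h2, ih hx, ih (by linarith)]
    have e1 : (ascPochhammer ℝ (n + 1)).eval x = x * (ascPochhammer ℝ n).eval (x + 1) := by
      simp [ascPochhammer_succ_left]
    have e2 : (ascPochhammer ℝ (n + 1 + 1)).eval x
        = x * (ascPochhammer ℝ n).eval (x + 1) * (x + (n + 1 : ℕ)) := by
      rw [ascPochhammer_succ_eval, e1]
    rw [e2, e1, ascPochhammer_succ_eval, Nat.factorial_succ]
    have hp : 0 < (ascPochhammer ℝ n).eval (x + 1) := ascPochhammer_pos _ _ (by linarith)
    have : x + 1 + n ≠ 0 := by positivity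
    have : x + (n + 1) ≠ 0 := by positivity
    push_cast
    field_simp
    ring

/-- As the lower parameter is `b + 1`, the quotient of its Pochhammer symbols telescopes to `b / (b
+ n)`. -/
lemma hasSum_ordinaryHypergeometric_div (m : ℕ) {b z : ℝ} (hb : 0 < b) (hz : |z| < 1) :
    HasSum (fun n : ℕ => ((n + m).choose m : ℝ) * z ^ n / (b + n))
      (₂F₁ ((m + 1 : ℕ) : ℝ) b (b + 1) z / b) := by
  have hterm (n : ℕ) : ((n.factorial⁻¹ : ℝ) * (ascPochhammer ℝ n).eval ((m + 1 : ℕ) : ℝ) *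
      (ascPochhammer ℝ n).eval b * ((ascPochhammer ℝ n).eval (b + 1))⁻¹) • z ^ n
      = b * (((n + m).choose m : ℝ) * z ^ n / (b + n)) := by
    have hp : 0 < (ascPochhammer ℝ n).eval (b + 1) := ascPochhammer_pos _ _ (by linarith)
    have e : (ascPochhammer ℝ n).eval b * (b + n) = b * (ascPochhammer ℝ n).eval (b + 1) := by
      rw [← ascPochhammer_succ_eval]; simp [ascPochhammer_succ_left]
    have hf : (n.factorial : ℝ) ≠ 0 := by exact_mod_cast n.factorial_ne_zero
    have hbn : b + n ≠ 0 := by positivity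
    rw [ascPochhammer_nat_eq_natCast_ascFactorial, Nat.ascFactorial_eq_factorial_mul_choose,
      eq_div_of_mul_eq hbn e, Nat.choose_symm_add.symm, Nat.add_comm m n]
    push_cast
    rw [smul_eq_mul]
    field_simp
  have hs : Summable fun n : ℕ => ((n + m).choose m : ℝ) * z ^ n / (b + n) := by
    have h := (summable_choose_mul_geometric_of_norm_lt_one m (r := |z|)
      (by simpa using hz)).mul_left b⁻¹
    refine Summable.of_norm_bounded h fun n => ?_
    rw [norm_div, norm_mul, norm_pow, Real.norm_eq_abs z, div_eq_inv_mul,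
      Real.norm_of_nonneg (by positivity : (0 : ℝ) ≤ b + n),
      Real.norm_of_nonneg (by positivity : (0 : ℝ) ≤ ((n + m).choose m : ℝ))]
    gcongr
    linarith [(Nat.cast_nonneg n : (0 : ℝ) ≤ n)]
  have h : ₂F₁ ((m + 1 : ℕ) : ℝ) b (b + 1) z / b
      = ∑' n : ℕ, ((n + m).choose m : ℝ) * z ^ n / (b + n) := by
    rw [ordinaryHypergeometric_eq_tsum]
    simp only [hterm]
    rw [tsum_mul_left, mul_div_cancel_left₀ _ hb.ne']
  rw [h]
  exact hs.hasSum

/-- The sum of hypergeometric functions in the high-SNR expression. -/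
noncomputable def hypergeometricSum (N : ℕ) (z : ℝ) : ℝ :=
  ∑ i ∈ Finset.range N, ((N - 1).choose i : ℝ) * (-1) ^ (N - i - 1) *
    (₂F₁ (N : ℝ) (2 * N - i - 1 : ℝ) (2 * N - i : ℝ) z / (2 * N - i - 1 : ℝ))

/-- The power series coefficients of `hypergeometricSum (m + 1)`. -/
noncomputable def hypergeometricSumCoeff (m n : ℕ) : ℝ :=
  ((n + 1).ascFactorial m : ℝ) / ((n + m + 1).ascFactorial (m + 1) : ℝ)

lemma hasSum_hypergeometricSum (m : ℕ) {z : ℝ} (hz : |z| < 1) :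
    HasSum (fun n => hypergeometricSumCoeff m n * z ^ n) (hypergeometricSum (m + 1) z) := by
  unfold hypergeometricSum
  have h : HasSum (fun n : ℕ => ∑ i ∈ Finset.range (m + 1),
      (((m + 1 - 1).choose i : ℝ) * (-1) ^ (m + 1 - i - 1)) *
        (((n + m).choose m : ℝ) * z ^ n / ((2 * (m + 1 : ℕ) - i - 1 : ℝ) + n)))
      (∑ i ∈ Finset.range (m + 1), ((m + 1 - 1).choose i : ℝ) * (-1) ^ (m + 1 - i - 1) *
    (₂F₁ ((m + 1 : ℕ) : ℝ) (2 * (m + 1 : ℕ) - i - 1 : ℝ) (2 * (m + 1 : ℕ) - i : ℝ) z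
      / (2 * (m + 1 : ℕ) - i - 1 : ℝ))) := by
    refine hasSum_sum fun i hi => HasSum.mul_left _ ?_
    have hi' : (i : ℝ) ≤ m := by exact_mod_cast Nat.lt_succ_iff.mp (Finset.mem_range.mp hi)
    have := hasSum_ordinaryHypergeometric_div m (b := 2 * (m + 1 : ℕ) - i - 1) (z := z)
      (by push_cast; linarith [(Nat.cast_nonneg m : (0 : ℝ) ≤ m)]) hz
    rwa [sub_add_cancel] at this
  convert! h using 1
  funext n
  -- With `k = m - i` the alternating sum over `i` is the partial fraction sum at `x = n + m + 1`.
  have hs := sum_choose_mul_neg_one_pow_div_add m (x := ((n + m + 1 : ℕ) : ℝ)) (by positivity)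
  rw [ascPochhammer_nat_eq_natCast_ascFactorial, ← Finset.sum_range_reflect] at hs
  have hc : ((n + 1).ascFactorial m : ℝ) = ((n + m).choose m : ℝ) * m.factorial := by
    rw [Nat.ascFactorial_eq_factorial_mul_choose]; push_cast; ring
  rw [hypergeometricSumCoeff, hc, mul_div_assoc, ← hs, Finset.mul_sum, Finset.sum_mul]
  refine Finset.sum_congr rfl fun i hi => ?_
  have hi' : i ≤ m := Nat.lt_succ_iff.mp (Finset.mem_range.mp hi)
  have e1 : m + 1 - 1 - i = m - i := by omega
  have e2 : m + 1 - i - 1 = m - i := by omega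
  rw [e1, e2, Nat.add_sub_cancel, Nat.choose_symm hi']
  have e3 : ((n + m + 1 : ℕ) : ℝ) + (m - i : ℕ) = 2 * (m + 1 : ℕ) - i - 1 + n := by
    rw [Nat.cast_sub hi']; push_cast; ring
  rw [e3]
  ring

lemma hypergeometricSumCoeff_le (m n : ℕ) : hypergeometricSumCoeff m n ≤ 1 / (n + 1) := by
  unfold hypergeometricSumCoeff
  have h1 : ((n + 1).ascFactorial m : ℝ) ≤ (n + m + 1 : ℝ) ^ m := by
    have := (n.ascFactorial_le_pow_add m).trans (Nat.pow_le_pow_left (Nat.le_succ _) m)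
    exact_mod_cast this
  have h2 : (n + m + 1 : ℝ) ^ (m + 1) ≤ ((n + m + 1).ascFactorial (m + 1) : ℝ) := by
    exact_mod_cast (n + m + 1).pow_succ_le_ascFactorial (m + 1)
  calc _ ≤ (n + m + 1 : ℝ) ^ m / (n + m + 1 : ℝ) ^ (m + 1) := by gcongr
    _ = 1 / (n + m + 1) := by rw [pow_succ]; field_simp
    _ ≤ 1 / (n + 1) := by gcongr; linarith [(Nat.cast_nonneg m : (0 : ℝ) ≤ m)]

/-- Every factor of the numerator is at least `n + 1` and every factor of the denominator at most `n
+ 2 m + 1`. Bernoulli's inequality linearises the resulting power. -/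
lemma sub_le_hypergeometricSumCoeff (m n : ℕ) :
    1 / (n + 1) - (m + 1) * (2 * m) / ((n : ℝ) + 1) ^ 2 ≤ hypergeometricSumCoeff m n := by
  unfold hypergeometricSumCoeff
  have h1 : ((n : ℝ) + 1) ^ m ≤ ((n + 1).ascFactorial m : ℝ) := by
    exact_mod_cast (n + 1).pow_succ_le_ascFactorial m
  have h2 : ((n + m + 1).ascFactorial (m + 1) : ℝ) ≤ (n + 2 * m + 1 : ℝ) ^ (m + 1) := by
    have := (n + m).ascFactorial_le_pow_add (m + 1)
    rw [show n + m + (m + 1) = n + 2 * m + 1 by ring] at this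
    exact_mod_cast this
  have hpos : (0 : ℝ) < (n + m + 1).ascFactorial (m + 1) := by
    exact_mod_cast (n + m).ascFactorial_pos (m + 1)
  have hn : (0 : ℝ) < (n : ℝ) + 1 := by positivity
  have hD : (0 : ℝ) < n + 2 * m + 1 := by positivity
  have hb := one_add_mul_le_pow (a := -(2 * m / (n + 2 * m + 1 : ℝ))) (by
    have : 2 * m / (n + 2 * m + 1 : ℝ) ≤ 1 := by
      rw [div_le_one hD]; linarith
    linarith) (m + 1)
  have e : 1 + -(2 * m / (n + 2 * m + 1 : ℝ)) = (n + 1) / (n + 2 * m + 1) := by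
    field_simp; ring
  rw [e] at hb
  calc 1 / (n + 1) - (m + 1) * (2 * m) / ((n : ℝ) + 1) ^ 2
      = 1 / (n + 1) * (1 + (m + 1) * -(2 * m / ((n : ℝ) + 1))) := by
        field_simp; ring
    _ ≤ 1 / (n + 1) * (1 + ((m + 1 : ℕ) : ℝ) * -(2 * m / (n + 2 * m + 1 : ℝ))) := by
        push_cast
        gcongr
        linarith [(Nat.cast_nonneg m : (0 : ℝ) ≤ m)]
    _ ≤ 1 / (n + 1) * ((n + 1) / (n + 2 * m + 1)) ^ (m + 1) := by gcongr
    _ = ((n : ℝ) + 1) ^ m / (n + 2 * m + 1 : ℝ) ^ (m + 1) := by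
        rw [div_pow, pow_succ ((n : ℝ) + 1)]; field_simp
    _ ≤ _ := by gcongr

/-- Compared term by term with the series of `-log (1 - z)`, the error is at most a summable `O(1 /
n²)`, uniformly in `z`. -/
lemma exists_abs_mul_hypergeometricSum_add_log_le (m : ℕ) :
    ∃ K : ℝ, ∀ z : ℝ, 0 < z → z < 1 → |z * hypergeometricSum (m + 1) z + Real.log (1 - z)| ≤ K := by
  have hsum : Summable fun n : ℕ => (m + 1) * (2 * m) / ((n : ℝ) + 1) ^ 2 := by
    have := ((summable_nat_add_iff 1).mpr
      (Real.summable_one_div_nat_pow.mpr one_lt_two)).mul_left ((m + 1) * (2 * m) : ℝ)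
    refine this.congr fun n => ?_
    push_cast; ring
  refine ⟨∑' n : ℕ, (m + 1) * (2 * m) / ((n : ℝ) + 1) ^ 2, fun z h0 h1 => ?_⟩
  have hz : |z| < 1 := by rw [abs_of_pos h0]; exact h1
  have ha := ((hasSum_hypergeometricSum m hz).mul_left z).sub
    (Real.hasSum_pow_div_log_of_abs_lt_one hz)
  rw [sub_neg_eq_add] at ha
  rw [← ha.tsum_eq, ← Real.norm_eq_abs]
  refine tsum_of_norm_bounded hsum.hasSum fun n => ?_
  have e : z * (hypergeometricSumCoeff m n * z ^ n) - z ^ (n + 1) / (n + 1)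
      = -(z ^ (n + 1) * (1 / (n + 1) - hypergeometricSumCoeff m n)) := by ring
  have hle := hypergeometricSumCoeff_le m n
  have hge := sub_le_hypergeometricSumCoeff m n
  rw [e, norm_neg, norm_mul, Real.norm_of_nonneg (by positivity : 0 ≤ z ^ (n + 1)),
    Real.norm_of_nonneg (by linarith)]
  calc _ ≤ 1 * (1 / (n + 1) - hypergeometricSumCoeff m n) := by
        have := pow_le_one₀ h0.le h1.le (n := n + 1)
        gcongr
    _ ≤ _ := by linarith

lemma tendsto_hypergeometricSum_div_log {N : ℕ} (hN : 0 < N) {κ : ℝ} (hκ : 0 < κ) :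
    Tendsto (fun ρ : ℝ => hypergeometricSum N (1 - κ / ρ) / Real.log ρ) atTop (𝓝 1) := by
  obtain ⟨m, rfl⟩ := Nat.exists_eq_add_one.mpr hN
  obtain ⟨K, hK⟩ := exists_abs_mul_hypergeometricSum_add_log_le m
  have hz : Tendsto (fun ρ : ℝ => 1 - κ / ρ) atTop (𝓝 1) := by
    simpa using (tendsto_const_nhds (x := (1 : ℝ))).sub
      ((tendsto_const_nhds (x := κ)).div_atTop tendsto_id)
  have hrest : Tendsto (fun ρ : ℝ => ((1 - κ / ρ) * hypergeometricSum (m + 1) (1 - κ / ρ)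
      - Real.log ρ) / Real.log ρ) atTop (𝓝 0) := by
    refine squeeze_zero_norm' (a := fun ρ => (K + |Real.log κ|) / Real.log ρ) ?_
      ((tendsto_const_nhds).div_atTop Real.tendsto_log_atTop)
    filter_upwards [eventually_gt_atTop κ, eventually_gt_atTop 1] with ρ h1 h2
    have hρ : 0 < ρ := hκ.trans h1
    have hlog := Real.log_pos h2
    rw [norm_div, Real.norm_of_nonneg hlog.le, Real.norm_eq_abs]
    gcongr
    have h := hK (1 - κ / ρ) (by rw [sub_pos, div_lt_one hρ]; exact h1)
      (by linarith [div_pos hκ hρ])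
    rw [sub_sub_cancel, Real.log_div hκ.ne' hρ.ne'] at h
    calc _ = |((1 - κ / ρ) * hypergeometricSum (m + 1) (1 - κ / ρ)
          + (Real.log κ - Real.log ρ)) + -Real.log κ| := by congr 1; ring
      _ ≤ _ := (abs_add_le _ _).trans (by rw [abs_neg]; gcongr)
  have := ((hrest.add_const 1).div hz one_ne_zero)
  simp only [zero_add, div_one] at this
  refine this.congr' ?_
  filter_upwards [eventually_gt_atTop κ, eventually_gt_atTop 1] with ρ h1 h2
  have hρ : 0 < ρ := hκ.trans h1
  have hlog := Real.log_pos h2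
  have : 1 - κ / ρ ≠ 0 := by
    have : κ / ρ < 1 := by rw [div_lt_one hρ]; exact h1
    linarith
  simp only [Pi.div_apply]
  field_simp
  ring

end Hypergeometric

/-! ### Small values of a product of two gamma variables -/

section GammaLaw

lemma lintegral_gammaMeasure_succ (m : ℕ) {f : ℝ → ENNReal} (hf : Measurable f) :
    ∫⁻ s, f s ∂gammaMeasure (m + 1 : ℕ) 1 = ∫⁻ s in Set.Ioi 0,
      ENNReal.ofReal (s ^ m * Real.exp (-s) / m.factorial) * f s := by
  rw [lintegral_gammaMeasure_natCast f hf]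
  simp [Real.Gamma_nat_eq_factorial]

lemma setLIntegral_pow_div_factorial (m : ℕ) {x : ℝ} (hx : 0 ≤ x) :
    ∫⁻ s in Set.Ioc 0 x, ENNReal.ofReal (s ^ m / m.factorial)
      = ENNReal.ofReal (x ^ (m + 1) / (m + 1).factorial) := by
  rw [← ofReal_integral_eq_lintegral_ofReal, ← intervalIntegral.integral_of_le hx,
    intervalIntegral.integral_div, integral_pow, Nat.factorial_succ]
  · congr 1
    have : (m.factorial : ℝ) ≠ 0 := by exact_mod_cast m.factorial_ne_zero
    push_cast; simp; field_simp
  · exact ((continuous_pow m).div_const _).integrableOn_Ioc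
  · refine (ae_restrict_iff' measurableSet_Ioc).mpr (ae_of_all _ fun s hs => ?_)
    have := hs.1.le
    simp only [Pi.zero_apply]; positivity

lemma gammaMeasure_succ_apply (m : ℕ) (s : Set ℝ) (hs : MeasurableSet s) :
    gammaMeasure (m + 1 : ℕ) 1 s = ∫⁻ t in s ∩ Set.Ioi 0,
      ENNReal.ofReal (t ^ m * Real.exp (-t) / m.factorial) := by
  rw [← lintegral_indicator_one hs, lintegral_gammaMeasure_succ m (measurable_one.indicator hs),
    ← setLIntegral_indicator hs]
  congr 1 with t
  by_cases h : t ∈ s <;> simp [h]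

lemma gammaMeasure_Iio_le (m : ℕ) {x : ℝ} (hx : 0 ≤ x) :
    gammaMeasure (m + 1 : ℕ) 1 (Set.Iio x) ≤ ENNReal.ofReal (x ^ (m + 1) / (m + 1).factorial) := by
  rw [gammaMeasure_succ_apply m _ measurableSet_Iio, ← setLIntegral_pow_div_factorial m hx]
  refine (lintegral_mono_set (t := Set.Ioc 0 x) fun t ht => ⟨ht.2, ht.1.le⟩).trans ?_
  refine setLIntegral_mono' measurableSet_Ioc fun t ht => ENNReal.ofReal_le_ofReal ?_
  have := ht.1.le
  gcongr
  exact mul_le_of_le_one_right (by positivity) (by simpa using this)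

lemma le_gammaMeasure_Iio (m : ℕ) {x : ℝ} (hx : 0 ≤ x) :
    ENNReal.ofReal (Real.exp (-x) * (x ^ (m + 1) / (m + 1).factorial))
      ≤ gammaMeasure (m + 1 : ℕ) 1 (Set.Iio x) := by
  rw [gammaMeasure_succ_apply m _ measurableSet_Iio, ENNReal.ofReal_mul (Real.exp_pos _).le,
    ← setLIntegral_pow_div_factorial m hx, ← lintegral_const_mul' _ _ ENNReal.ofReal_ne_top,
    setLIntegral_congr (Ioo_ae_eq_Ioc (a := (0 : ℝ)) (b := x)).symm, Set.inter_comm,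
    Set.Ioi_inter_Iio]
  refine setLIntegral_mono' measurableSet_Ioo fun t ht => ?_
  rw [← ENNReal.ofReal_mul (Real.exp_pos _).le]
  refine ENNReal.ofReal_le_ofReal ?_
  have h0 := ht.1.le
  have h1 := ht.2.le
  rw [mul_comm, div_mul_eq_mul_div]
  gcongr

/-- The probability that a product of two independent gamma variables is less than `δ`. -/
noncomputable def gammaProdCDF (m : ℕ) (δ : ℝ) : ENNReal :=
  (gammaMeasure (m + 1 : ℕ) 1).prod (gammaMeasure (m + 1 : ℕ) 1) {q : ℝ × ℝ | q.1 * q.2 < δ}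

instance isProbabilityMeasure_gammaMeasure_succ (m : ℕ) :
    IsProbabilityMeasure (gammaMeasure (m + 1 : ℕ) 1) :=
  isProbabilityMeasure_gammaMeasure (by positivity) one_pos

lemma gammaProdCDF_eq (m : ℕ) (δ : ℝ) :
    gammaProdCDF m δ = ∫⁻ s in Set.Ioi 0, ENNReal.ofReal (s ^ m * Real.exp (-s) / m.factorial) *
      gammaMeasure (m + 1 : ℕ) 1 (Set.Iio (δ / s)) := by
  have hms : MeasurableSet {q : ℝ × ℝ | q.1 * q.2 < δ} :=
    measurableSet_lt (by fun_prop) measurable_const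
  rw [gammaProdCDF, Measure.prod_apply hms,
    lintegral_gammaMeasure_succ m (measurable_measure_prodMk_left hms)]
  refine setLIntegral_congr_fun measurableSet_Ioi fun s (hs : 0 < s) => ?_
  have : Prod.mk s ⁻¹' {q : ℝ × ℝ | q.1 * q.2 < δ} = Set.Iio (δ / s) := by
    ext t; simp [lt_div_iff₀ hs, mul_comm]
  simp only [this]

lemma setLIntegral_const_mul_inv {c x y : ℝ} (hc : 0 ≤ c) (hx : 0 < x) (hxy : x ≤ y) :
    ∫⁻ s in Set.Ioc x y, ENNReal.ofReal (c * s⁻¹)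
      = ENNReal.ofReal (c * Real.log (y / x)) := by
  have hnot : (0 : ℝ) ∉ Set.uIcc x y := by
    rw [Set.uIcc_of_le hxy]; exact fun h => absurd h.1 (not_le.mpr hx)
  rw [← ofReal_integral_eq_lintegral_ofReal, ← intervalIntegral.integral_of_le hxy,
    intervalIntegral.integral_const_mul, integral_inv hnot]
  · have : IntervalIntegrable (fun s : ℝ => s⁻¹) volume x y :=
      intervalIntegral.intervalIntegrable_inv (fun s hs h => hnot (h ▸ hs)) continuousOn_id
    exact ((intervalIntegrable_iff_integrableOn_Ioc_of_le hxy).mp this).const_mul c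
  · refine (ae_restrict_iff' measurableSet_Ioc).mpr (ae_of_all _ fun s hs => ?_)
    have := hx.trans hs.1
    simp only [Pi.zero_apply]; positivity

/-- Split the first variable `s` at `δ` and `1`. In the middle range the density times the
conditional probability is at most a multiple of `s ^ m (δ / s) ^ (m + 1) = δ ^ (m + 1) / s`, which
integrates to the logarithm. The outer ranges give only `δ ^ (m + 1)`. -/
lemma gammaProdCDF_le (m : ℕ) {δ : ℝ} (h0 : 0 < δ) (h1 : δ < 1) :
    gammaProdCDF m δ ≤ ENNReal.ofReal (δ ^ (m + 1) / (m + 1).factorial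
      + δ ^ (m + 1) / (m.factorial * (m + 1).factorial) * Real.log (1 / δ)
      + δ ^ (m + 1) / (m + 1).factorial) := by
  have hlog : 0 ≤ Real.log (1 / δ) := Real.log_nonneg (by rw [le_div_iff₀ h0]; linarith)
  rw [gammaProdCDF_eq, ← Set.Ioc_union_Ioi_eq_Ioi h0.le,
    lintegral_union measurableSet_Ioi (Set.Ioc_disjoint_Ioi le_rfl),
    ← Set.Ioc_union_Ioi_eq_Ioi h1.le, lintegral_union measurableSet_Ioi
      (Set.Ioc_disjoint_Ioi le_rfl), ← add_assoc, ENNReal.ofReal_add (by positivity) (by positivity),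
    ENNReal.ofReal_add (by positivity) (by positivity)]
  have hexp {s : ℝ} (hs : 0 ≤ s) : s ^ m * Real.exp (-s) / m.factorial ≤ s ^ m / m.factorial := by
    gcongr
    exact mul_le_of_le_one_right (by positivity) (by simpa using hs)
  refine add_le_add (add_le_add ?_ ?_) ?_
  · rw [← setLIntegral_pow_div_factorial m h0.le]
    refine setLIntegral_mono' measurableSet_Ioc fun s hs => ?_
    refine (mul_le_of_le_one_right' prob_le_one).trans (ENNReal.ofReal_le_ofReal (hexp hs.1.le))
  · rw [← setLIntegral_const_mul_inv (by positivity) h0 h1.le]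
    refine setLIntegral_mono' measurableSet_Ioc fun s hs => ?_
    have hs0 : 0 < s := h0.trans hs.1
    refine (mul_le_mul' (ENNReal.ofReal_le_ofReal (hexp hs0.le))
      (gammaMeasure_Iio_le m (by positivity : 0 ≤ δ / s))).trans ?_
    rw [← ENNReal.ofReal_mul (by positivity)]
    refine ENNReal.ofReal_le_ofReal (le_of_eq ?_)
    rw [div_pow, pow_succ s]
    field_simp
  · have htot : ∫⁻ s in Set.Ioi (0 : ℝ), ENNReal.ofReal (s ^ m * Real.exp (-s) / m.factorial) = 1 := by
      have := lintegral_gammaMeasure_succ m (f := fun _ => 1) measurable_const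
      simp only [lintegral_const, measure_univ, mul_one] at this
      exact this.symm
    calc _ ≤ ∫⁻ s in Set.Ioi (1 : ℝ), ENNReal.ofReal (s ^ m * Real.exp (-s) / m.factorial)
          * ENNReal.ofReal (δ ^ (m + 1) / (m + 1).factorial) := by
          refine setLIntegral_mono' measurableSet_Ioi fun s (hs : 1 < s) => ?_
          have hs0 : 0 < s := one_pos.trans hs
          refine mul_le_mul' le_rfl ((gammaMeasure_Iio_le m (by positivity)).trans
            (ENNReal.ofReal_le_ofReal ?_))
          gcongr
          exact div_le_self h0.le hs.le
      _ ≤ ∫⁻ s in Set.Ioi (0 : ℝ), ENNReal.ofReal (s ^ m * Real.exp (-s) / m.factorial)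
          * ENNReal.ofReal (δ ^ (m + 1) / (m + 1).factorial) :=
          lintegral_mono_set (Set.Ioi_subset_Ioi zero_le_one)
      _ = _ := by
          rw [lintegral_mul_const' _ _ ENNReal.ofReal_ne_top, htot, one_mul]

/-- Restrict to `B δ < s ≤ 1 / B`: there `s` and `δ / s` are both at most `1 / B`, so each of the
two exponentials costs at most a factor `exp (-1 / B)`. Letting `B` grow after `δ → 0` recovers the
sharp constant. -/
lemma le_gammaProdCDF (m : ℕ) {δ B : ℝ} (h0 : 0 < δ) (hB : 0 < B) (h1 : B ^ 2 * δ ≤ 1) :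
    ENNReal.ofReal (Real.exp (-(2 / B)) * (δ ^ (m + 1) / (m.factorial * (m + 1).factorial))
      * Real.log (1 / (B ^ 2 * δ))) ≤ gammaProdCDF m δ := by
  have hle : B * δ ≤ 1 / B := by rw [le_div_iff₀ hB]; linarith [h1, sq B, mul_comm B (B * δ)]
  have e : 1 / (B ^ 2 * δ) = 1 / B / (B * δ) := by field_simp
  rw [gammaProdCDF_eq, e, ← setLIntegral_const_mul_inv (by positivity) (by positivity) hle]
  refine (setLIntegral_mono' measurableSet_Ioc fun s hs => ?_).trans
    (lintegral_mono_set fun s (hs : s ∈ Set.Ioc (B * δ) (1 / B)) =>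
      (mul_pos hB h0).trans hs.1)
  have hs0 : 0 < s := (mul_pos hB h0).trans hs.1
  have hδs : δ / s ≤ 1 / B := by
    rw [div_le_div_iff₀ hs0 hB]; linarith [hs.1]
  refine le_trans ?_ (mul_le_mul' le_rfl (le_gammaMeasure_Iio m (by positivity : 0 ≤ δ / s)))
  rw [← ENNReal.ofReal_mul (by positivity)]
  refine ENNReal.ofReal_le_ofReal ?_
  calc _ = (s ^ m * Real.exp (-(1 / B)) / m.factorial) * (Real.exp (-(1 / B)) *
        ((δ / s) ^ (m + 1) / (m + 1).factorial)) := by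
        have : Real.exp (-(2 / B)) = Real.exp (-(1 / B)) * Real.exp (-(1 / B)) := by
          rw [← Real.exp_add]; ring_nf
        rw [this, div_pow, pow_succ s]
        field_simp
    _ ≤ _ := by
        have := hs.2
        gcongr

lemma toReal_gammaProdCDF_le (m : ℕ) {δ : ℝ} (h0 : 0 < δ) (h1 : δ < 1) :
    (gammaProdCDF m δ).toReal ≤ δ ^ (m + 1) / (m + 1).factorial
      + δ ^ (m + 1) / (m.factorial * (m + 1).factorial) * Real.log (1 / δ)
      + δ ^ (m + 1) / (m + 1).factorial := by
  have hlog : 0 ≤ Real.log (1 / δ) := Real.log_nonneg (by rw [le_div_iff₀ h0]; linarith)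
  exact ENNReal.toReal_le_of_le_ofReal (by positivity) (gammaProdCDF_le m h0 h1)

lemma le_toReal_gammaProdCDF (m : ℕ) {δ B : ℝ} (h0 : 0 < δ) (hB : 0 < B) (h1 : B ^ 2 * δ ≤ 1) :
    Real.exp (-(2 / B)) * (δ ^ (m + 1) / (m.factorial * (m + 1).factorial))
      * Real.log (1 / (B ^ 2 * δ)) ≤ (gammaProdCDF m δ).toReal :=
  (ENNReal.ofReal_le_iff_le_toReal (measure_ne_top _ _)).mp (le_gammaProdCDF m h0 hB h1)

lemma tendsto_log_const_mul_div_log {c : ℝ} (hc : 0 < c) :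
    Tendsto (fun ρ : ℝ => Real.log (c * ρ) / Real.log ρ) atTop (𝓝 1) := by
  have h : Tendsto (fun ρ : ℝ => Real.log c / Real.log ρ + 1) atTop (𝓝 (0 + 1)) :=
    ((tendsto_const_nhds).div_atTop Real.tendsto_log_atTop).add_const 1
  rw [zero_add] at h
  refine h.congr' ?_
  filter_upwards [eventually_gt_atTop 1] with ρ hρ
  have := Real.log_pos hρ
  rw [Real.log_mul hc.ne' (by positivity)]
  field_simp

lemma tendsto_gammaProdCDF_mul_pow_div_log (m : ℕ) {c : ℝ} (hc : 0 < c) :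
    Tendsto (fun ρ : ℝ => (gammaProdCDF m (c / ρ)).toReal * (ρ ^ (m + 1) / Real.log ρ)) atTop
      (𝓝 (c ^ (m + 1) / (m.factorial * (m + 1).factorial))) := by
  set L : ℝ := c ^ (m + 1) / (m.factorial * (m + 1).factorial) with hL
  refine tendsto_order.2 ⟨fun a ha => ?_, fun a ha => ?_⟩
  · have hlim : Tendsto (fun B : ℝ => Real.exp (-(2 / B)) * L) atTop (𝓝 L) := by
      have : Tendsto (fun B : ℝ => -(2 / B)) atTop (𝓝 (-0)) :=
        ((tendsto_const_nhds).div_atTop tendsto_id).neg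
      rw [neg_zero] at this
      simpa using ((Real.continuous_exp.tendsto 0).comp this).mul_const L
    obtain ⟨B, hBa, hB⟩ := (((tendsto_order.1 hlim).1 a ha).and (eventually_gt_atTop 0)).exists
    have h2 := (tendsto_log_const_mul_div_log (c := 1 / (B ^ 2 * c)) (by positivity)).const_mul
      (Real.exp (-(2 / B)) * L)
    rw [mul_one] at h2
    filter_upwards [(tendsto_order.1 h2).1 a hBa, eventually_ge_atTop (B ^ 2 * c),
      eventually_gt_atTop 1] with ρ h3 h4 h5
    refine h3.trans_le ?_
    have hρ : 0 < ρ := one_pos.trans h5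
    have hlog := Real.log_pos h5
    have h6 := le_toReal_gammaProdCDF m (δ := c / ρ) (B := B) (by positivity) hB
      (by rw [← mul_div_assoc, div_le_one hρ]; exact h4)
    calc _ = Real.exp (-(2 / B)) * ((c / ρ) ^ (m + 1) / (m.factorial * (m + 1).factorial))
      * Real.log (1 / (B ^ 2 * (c / ρ))) * (ρ ^ (m + 1) / Real.log ρ) := by
          rw [hL, div_pow]
          have : 1 / (B ^ 2 * (c / ρ)) = 1 / (B ^ 2 * c) * ρ := by field_simp
          rw [this]
          field_simp
      _ ≤ _ := by gcongr
  · have h2 : Tendsto (fun ρ : ℝ => 2 * c ^ (m + 1) / (m + 1).factorial / Real.log ρ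
        + L * (Real.log (1 / c * ρ) / Real.log ρ)) atTop (𝓝 (0 + L * 1)) :=
      ((tendsto_const_nhds).div_atTop Real.tendsto_log_atTop).add
        ((tendsto_log_const_mul_div_log (by positivity)).const_mul L)
    rw [zero_add, mul_one] at h2
    filter_upwards [(tendsto_order.1 h2).2 a ha, eventually_gt_atTop c,
      eventually_gt_atTop 1] with ρ h3 h4 h5
    refine lt_of_le_of_lt ?_ h3
    have hρ : 0 < ρ := one_pos.trans h5
    have hlog := Real.log_pos h5
    have h6 := toReal_gammaProdCDF_le m (δ := c / ρ) (by positivity)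
      (by rw [div_lt_one hρ]; exact h4)
    calc _ ≤ _ := mul_le_mul_of_nonneg_right h6 (by positivity)
      _ = _ := by
          rw [hL, div_pow]
          have : 1 / (c / ρ) = 1 / c * ρ := by field_simp
          rw [this]
          field_simp
          ring

end GammaLaw

/-! ### Outage asymptotics of a two-hop link with gamma gains -/

section OutageAsymptotics

lemma lintegral_one_add_mul_pow_gammaMeasure_lt_top (m : ℕ) {b : ℝ} (hb : 0 ≤ b) :
    ∫⁻ t, ENNReal.ofReal ((b * t + 1) ^ (m + 1)) ∂gammaMeasure (m + 1 : ℕ) 1 < ⊤ := by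
  rw [lintegral_gammaMeasure_succ m (by fun_prop)]
  have h1 := Real.GammaIntegral_convergent (s := m + 1) (by positivity)
  have h2 := Real.GammaIntegral_convergent (s := (m + (m + 1) : ℕ) + 1) (by positivity)
  have h3 := (((h2.const_mul (b ^ (m + 1))).add h1).const_mul (2 ^ m / m.factorial : ℝ))
  refine lt_of_le_of_lt (setLIntegral_mono' measurableSet_Ioi fun s (hs : 0 < s) => ?_)
    h3.lintegral_lt_top
  rw [← ENNReal.ofReal_mul (by positivity)]
  refine ENNReal.ofReal_le_ofReal ?_
  have h := add_pow_le (by positivity : 0 ≤ b * s) zero_le_one (m + 1)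
  simp only [Nat.add_sub_cancel, one_pow] at h
  simp only [add_sub_cancel_right, Real.rpow_natCast, Pi.add_apply]
  calc _ ≤ s ^ m * Real.exp (-s) / m.factorial * (2 ^ m * ((b * s) ^ (m + 1) + 1)) := by gcongr
    _ = _ := by rw [mul_pow, pow_add s m]; ring

variable {Ω : Type*} [MeasurableSpace Ω] {P : Measure Ω} {m : ℕ} {S₁ SI S₂ : Ω → ℝ}

/-- Three independent gamma variables of shape `m + 1`. -/
def HasGammaTripleLaw (P : Measure Ω) (m : ℕ) (S₁ SI S₂ : Ω → ℝ) : Prop :=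
  HasLaw (fun ω => (S₁ ω, SI ω, S₂ ω)) ((gammaMeasure (m + 1 : ℕ) 1).prod
    ((gammaMeasure (m + 1 : ℕ) 1).prod (gammaMeasure (m + 1 : ℕ) 1))) P

lemma HasGammaTripleLaw.measure_mul_lt (h : HasGammaTripleLaw P m S₁ SI S₂) (δ : ℝ) :
    P {ω | S₁ ω * S₂ ω < δ} = gammaProdCDF m δ := by
  have hp := (MeasurePreserving.id (gammaMeasure (m + 1 : ℕ) 1)).prod
    (measurePreserving_snd (μ := gammaMeasure (m + 1 : ℕ) 1) (ν := gammaMeasure (m + 1 : ℕ) 1))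
  exact (hp.comp_hasLaw h).measure_eq (p := fun q : ℝ × ℝ => q.1 * q.2 < δ)
    (measurableSet_lt (by fun_prop) measurable_const)

lemma HasGammaTripleLaw.measure_lt_and_mul_lt_and_lt (h : HasGammaTripleLaw P m S₁ SI S₂)
    (B β δ : ℝ) : gammaMeasure (m + 1 : ℕ) 1 (Set.Iio B) *
      (gammaMeasure (m + 1 : ℕ) 1).prod (gammaMeasure (m + 1 : ℕ) 1)
        {q : ℝ × ℝ | q.1 * q.2 < δ ∧ q.2 < β}
      = P {ω | SI ω < B ∧ S₁ ω * S₂ ω < δ ∧ S₂ ω < β} := by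
  set G := gammaMeasure (m + 1 : ℕ) 1
  have hme : MeasurePreserving (fun q : ℝ × ℝ × ℝ => (q.2.1, q.1, q.2.2))
      (G.prod (G.prod G)) (G.prod (G.prod G)) := by
    have e1 := (measurePreserving_prodAssoc G G G).symm
    have e2 := (Measure.measurePreserving_swap (μ := G) (ν := G)).prod (MeasurePreserving.id G)
    have e3 := measurePreserving_prodAssoc G G G
    exact e3.comp (e2.comp e1)
  have hms : MeasurableSet {q : ℝ × ℝ | q.1 * q.2 < δ ∧ q.2 < β} := by
    rw [Set.ofPred_and]
    exact (measurableSet_lt (by fun_prop) measurable_const).inter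
      (measurableSet_lt (by fun_prop) measurable_const)
  have h2 := (hme.comp_hasLaw h).measure_eq
    (p := fun q : ℝ × ℝ × ℝ => q.1 < B ∧ q.2.1 * q.2.2 < δ ∧ q.2.2 < β)
    (measurableSet_Iio.prod hms)
  rw [← Measure.prod_prod]
  exact h2.symm

/-- Condition on `SI` and apply the power bound for the gamma distribution function. With `x` of
order `1 / ρ` this makes a weak first hop an event of probability `O(ρ ^ (-(m + 1)))`, without the
logarithm. -/
lemma HasGammaTripleLaw.measure_lt_mul_le (h : HasGammaTripleLaw P m S₁ SI S₂)
    (hSI : ∀ ω, 0 ≤ SI ω) {b x : ℝ} (hb : 0 ≤ b) (hx : 0 ≤ x) :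
    P {ω | S₁ ω < x * (b * SI ω + 1)} ≤ ENNReal.ofReal (x ^ (m + 1) / (m + 1).factorial) *
      ∫⁻ t, ENNReal.ofReal ((b * t + 1) ^ (m + 1)) ∂gammaMeasure (m + 1 : ℕ) 1 := by
  set G := gammaMeasure (m + 1 : ℕ) 1
  have hp := (MeasurePreserving.id G).prod (measurePreserving_fst (μ := G) (ν := G))
  have hms : MeasurableSet {q : ℝ × ℝ | q.1 < x * (b * q.2 + 1) ∧ 0 ≤ q.2} := by
    rw [Set.ofPred_and]
    exact (measurableSet_lt (by fun_prop) (by fun_prop)).inter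
      (measurableSet_le measurable_const (by fun_prop))
  have h1 : P {ω | S₁ ω < x * (b * SI ω + 1)}
      = G.prod G {q : ℝ × ℝ | q.1 < x * (b * q.2 + 1) ∧ 0 ≤ q.2} := by
    rw [← (hp.comp_hasLaw h).measure_eq
      (p := fun q : ℝ × ℝ => q.1 < x * (b * q.2 + 1) ∧ 0 ≤ q.2) hms]
    congr 1 with ω
    simp [hSI ω]
  rw [h1, Measure.prod_apply_symm hms, ← lintegral_const_mul' _ _ ENNReal.ofReal_ne_top]
  refine lintegral_mono fun t => ?_
  by_cases ht : 0 ≤ t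
  · have hs : (fun s => (s, t)) ⁻¹' {q : ℝ × ℝ | q.1 < x * (b * q.2 + 1) ∧ 0 ≤ q.2}
        = Set.Iio (x * (b * t + 1)) := by
      ext s; simp [ht]
    rw [hs, ← ENNReal.ofReal_mul (by positivity)]
    refine (gammaMeasure_Iio_le m (by positivity)).trans (ENNReal.ofReal_le_ofReal (le_of_eq ?_))
    rw [mul_pow]; ring
  · have hs : (fun s => (s, t)) ⁻¹' {q : ℝ × ℝ | q.1 < x * (b * q.2 + 1) ∧ 0 ≤ q.2} = ∅ := by
      ext s; simp [ht]
    rw [hs]; simp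

/-- For large `ρ`, the outage probability of a two-hop link is governed by its second hop. -/
theorem HasGammaTripleLaw.tendsto_outage [IsProbabilityMeasure P]
    (h : HasGammaTripleLaw P m S₁ SI S₂)
    (hS₁ : ∀ ω, 0 ≤ S₁ ω) (hSI : ∀ ω, 0 ≤ SI ω) (hS₂ : ∀ ω, 0 ≤ S₂ ω) {a b k e g : ℝ}
    (ha : 0 < a) (hb : 0 ≤ b) (hk : 0 < k) (he : 0 ≤ e) (hg : 0 < g) (X : ℝ → Ω → ℝ)
    (hX : ∀ ρ, 0 < ρ → ∀ ω, a * ρ * S₁ ω / (b * SI ω + 1) ≤ X ρ ω) :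
    Tendsto (fun ρ : ℝ => P.real {ω | twoHopRatio (X ρ ω) (k * (ρ * S₁ ω + e * SI ω) * S₂ ω) < g}
      * (ρ ^ (m + 1) / Real.log ρ)) atTop
      (𝓝 ((g / k) ^ (m + 1) / (m.factorial * (m + 1).factorial))) := by
  have hX0 : ∀ ρ, 0 < ρ → ∀ ω, 0 ≤ X ρ ω := fun ρ hρ ω => by
    refine le_trans ?_ (hX ρ hρ ω)
    have := hS₁ ω
    have := hSI ω
    positivity
  have hY0 : ∀ ρ, 0 < ρ → ∀ ω, 0 ≤ k * (ρ * S₁ ω + e * SI ω) * S₂ ω := fun ρ hρ ω => by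
    have := hS₁ ω
    have := hSI ω
    have := hS₂ ω
    positivity
  set F : ℝ := m.factorial * (m + 1).factorial with hF
  have hFpos : 0 < F := by positivity
  refine tendsto_order.2 ⟨fun l hl => ?_, fun l hl => ?_⟩
  -- Lower bound: `q < 1` close to `1` serves twice, as the probability kept when `SI` is truncated
  -- at `B`, and as the share of the threshold given to the source term of `y`.
  · have hlim : Tendsto (fun q : ℝ => q * ((q * g / k) ^ (m + 1) / F)) (𝓝[<] 1)
        (𝓝 ((g / k) ^ (m + 1) / F)) := by
      have hc : Continuous fun q : ℝ => q * ((q * g / k) ^ (m + 1) / F) := by fun_prop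
      have := (hc.tendsto 1).mono_left (nhdsWithin_le_nhds (s := Set.Iio 1))
      simpa using this
    obtain ⟨q, hql, hq1, hq0⟩ := (((tendsto_order.1 hlim).1 l hl).and
      ((eventually_mem_nhdsWithin).and
        (mem_nhdsWithin_of_mem_nhds (lt_mem_nhds (zero_lt_one (α := ℝ)))))).exists
    have hq1 : q < 1 := hq1
    have hq0 : 0 < q := hq0
    obtain ⟨B, hBq, hB⟩ : ∃ B : ℝ, q ≤ (gammaMeasure (m + 1 : ℕ) 1 (Set.Iio B)).toReal ∧ 0 < B := by
      have h1 : Tendsto (fun B : ℝ => (gammaMeasure (m + 1 : ℕ) 1 (Set.Iio B)).toReal) atTop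
          (𝓝 1) := by
        have := tendsto_measure_iUnion_atTop (μ := gammaMeasure (m + 1 : ℕ) 1)
          (s := fun B : ℝ => Set.Iio B) (fun x y hxy => Set.Iio_subset_Iio hxy)
        rw [Set.iUnion_Iio, measure_univ] at this
        exact (ENNReal.tendsto_toReal ENNReal.one_ne_top).comp this
      obtain ⟨B, hB⟩ := (((tendsto_order.1 h1).1 q hq1).and (eventually_gt_atTop 0)).exists
      exact ⟨B, hB.1.le, hB.2⟩
    -- Truncating `S₂` at `β` keeps the interferer term of `y` within the remaining share of the
    -- threshold. The `+ 1` in the witness covers `e = 0`.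
    obtain ⟨β, hβ, hβle⟩ : ∃ β : ℝ, 0 < β ∧ k * e * B * β ≤ (1 - q) * g := by
      refine ⟨(1 - q) * g / (k * e * B + 1), div_pos (mul_pos (by linarith) hg) (by positivity), ?_⟩
      rw [mul_div_assoc', div_le_iff₀ (by positivity)]
      nlinarith [mul_pos (sub_pos.mpr hq1) hg]
    set c := q * g / k with hc
    have hcpos : 0 < c := by positivity
    have h3 : Tendsto (fun ρ : ℝ => q * ((gammaProdCDF m (c / ρ)).toReal * (ρ ^ (m + 1) / Real.log ρ)
        - ((c / β) ^ (m + 1) / (m + 1).factorial) / Real.log ρ)) atTop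
        (𝓝 (q * (c ^ (m + 1) / F - 0))) :=
      ((tendsto_gammaProdCDF_mul_pow_div_log m hcpos).sub
        ((tendsto_const_nhds).div_atTop Real.tendsto_log_atTop)).const_mul q
    rw [sub_zero] at h3
    filter_upwards [(tendsto_order.1 h3).1 l hql, eventually_gt_atTop 1] with ρ h4 h5
    refine h4.trans_le ?_
    have hρ : 0 < ρ := one_pos.trans h5
    have hlog := Real.log_pos h5
    set G := gammaMeasure (m + 1 : ℕ) 1 with hG
    have hsub : {ω | SI ω < B ∧ S₁ ω * S₂ ω < c / ρ ∧ S₂ ω < β} ⊆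
        {ω | twoHopRatio (X ρ ω) (k * (ρ * S₁ ω + e * SI ω) * S₂ ω) < g} := by
      rintro ω ⟨w1, w2, w3⟩
      refine (twoHopRatio_le_right (hX0 ρ hρ ω) (hY0 ρ hρ ω)).trans_lt ?_
      have e1 : k * ρ * (S₁ ω * S₂ ω) < q * g := by
        rw [lt_div_iff₀ hρ, hc, lt_div_iff₀ hk] at w2
        linarith
      have e2 : k * e * (SI ω * S₂ ω) ≤ k * e * (B * β) := by
        have := hSI ω
        have := hS₂ ω
        gcongr
      nlinarith
    -- Dropping `S₂ ≥ β` is harmless: there `S₁ < c / (ρ β)`, an event of order `ρ ^ (-(m + 1))`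
    -- that loses to the logarithm.
    have hQ : gammaProdCDF m (c / ρ) ≤ G.prod G {q : ℝ × ℝ | q.1 * q.2 < c / ρ ∧ q.2 < β}
        + ENNReal.ofReal ((c / ρ / β) ^ (m + 1) / (m + 1).factorial) := by
      have hneg : ∀ᵐ x ∂G, 0 ≤ x := by
        rw [ae_iff, hG]
        have : {x : ℝ | ¬ 0 ≤ x} = Set.Iio 0 := by ext; simp
        rw [this]
        refine le_antisymm ((gammaMeasure_Iio_le m le_rfl).trans ?_) zero_le
        simp
      have hnegp : ∀ᵐ q ∂G.prod G, 0 ≤ q.1 :=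
        (Measure.quasiMeasurePreserving_fst (μ := G) (ν := G)).ae hneg
      have h6 : gammaProdCDF m (c / ρ) ≤ G.prod G
          ({q : ℝ × ℝ | q.1 * q.2 < c / ρ ∧ q.2 < β} ∪ Set.Iio (c / ρ / β) ×ˢ Set.univ) := by
        refine measure_mono_ae ?_
        filter_upwards [hnegp] with q hq0 hq
        have hq : q.1 * q.2 < c / ρ := hq
        by_cases hqβ : q.2 < β
        · exact Or.inl ⟨hq, hqβ⟩
        · refine Or.inr ⟨?_, trivial⟩
          rw [Set.mem_Iio, lt_div_iff₀ hβ]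
          nlinarith
      refine h6.trans ((measure_union_le _ _).trans (add_le_add le_rfl ?_))
      rw [Measure.prod_prod, measure_univ, mul_one]
      exact gammaMeasure_Iio_le m (by positivity)
    have hQr : (gammaProdCDF m (c / ρ)).toReal - (c / ρ / β) ^ (m + 1) / (m + 1).factorial
        ≤ (G.prod G {q : ℝ × ℝ | q.1 * q.2 < c / ρ ∧ q.2 < β}).toReal := by
      have := ENNReal.toReal_mono (by finiteness) hQ
      rw [ENNReal.toReal_add (by finiteness) (by finiteness),
        ENNReal.toReal_ofReal (by positivity)] at this
      linarith
    have hP : (G (Set.Iio B)).toReal *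
        (G.prod G {q : ℝ × ℝ | q.1 * q.2 < c / ρ ∧ q.2 < β}).toReal
        ≤ P.real {ω | twoHopRatio (X ρ ω) (k * (ρ * S₁ ω + e * SI ω) * S₂ ω) < g} := by
      rw [← ENNReal.toReal_mul, h.measure_lt_and_mul_lt_and_lt B β (c / ρ)]
      exact measureReal_mono hsub
    calc _ = q * ((gammaProdCDF m (c / ρ)).toReal - (c / ρ / β) ^ (m + 1) / (m + 1).factorial)
          * (ρ ^ (m + 1) / Real.log ρ) := by
          have : c / ρ / β = c / β / ρ := by ring
          rw [this, div_pow (c / β) ρ]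
          field_simp
      _ ≤ q * (G.prod G {q : ℝ × ℝ | q.1 * q.2 < c / ρ ∧ q.2 < β}).toReal
          * (ρ ^ (m + 1) / Real.log ρ) := by gcongr
      _ ≤ (G (Set.Iio B)).toReal * (G.prod G {q : ℝ × ℝ | q.1 * q.2 < c / ρ ∧ q.2 < β}).toReal
          * (ρ ^ (m + 1) / Real.log ρ) := by gcongr
      _ ≤ _ := by gcongr
  -- Upper bound: either the first-hop ratio is below a fixed large `M`, which is rare, or `y` is
  -- below a threshold that tends to `g` as `M` grows. In the second case the nonnegative interferer
  -- term may be discarded.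
  · have hlim : Tendsto (fun M : ℝ => ((g + (g ^ 2 + g) / (M - g)) / k) ^ (m + 1) / F) atTop
        (𝓝 (((g + 0) / k) ^ (m + 1) / F)) := by
      refine Tendsto.div_const (Tendsto.pow (Tendsto.div_const (Tendsto.const_add _ ?_) _) _) _
      exact (tendsto_const_nhds).div_atTop (tendsto_atTop_add_const_right _ _ tendsto_id)
    rw [add_zero] at hlim
    obtain ⟨M, hMl, hM⟩ := (((tendsto_order.1 hlim).2 l hl).and (eventually_gt_atTop g)).exists
    set c := (g + (g ^ 2 + g) / (M - g)) / k with hc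
    have hMg : 0 < M - g := sub_pos.mpr hM
    have hMpos : 0 < M := hg.trans hM
    have hcpos : 0 < c := by positivity
    set I := ∫⁻ t, ENNReal.ofReal ((b * t + 1) ^ (m + 1)) ∂gammaMeasure (m + 1 : ℕ) 1 with hI
    have hItop : I ≠ ⊤ := (lintegral_one_add_mul_pow_gammaMeasure_lt_top m hb).ne
    have h3 : Tendsto (fun ρ : ℝ => ((M / a) ^ (m + 1) / (m + 1).factorial * I.toReal) / Real.log ρ
        + (gammaProdCDF m (c / ρ)).toReal * (ρ ^ (m + 1) / Real.log ρ)) atTop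
        (𝓝 (0 + c ^ (m + 1) / F)) :=
      ((tendsto_const_nhds).div_atTop Real.tendsto_log_atTop).add
        (tendsto_gammaProdCDF_mul_pow_div_log m hcpos)
    rw [zero_add] at h3
    filter_upwards [(tendsto_order.1 h3).2 l hMl, eventually_gt_atTop 1] with ρ h4 h5
    refine lt_of_le_of_lt ?_ h4
    have hρ : 0 < ρ := one_pos.trans h5
    have hlog := Real.log_pos h5
    have hsub : {ω | twoHopRatio (X ρ ω) (k * (ρ * S₁ ω + e * SI ω) * S₂ ω) < g} ⊆
        {ω | S₁ ω < M / (a * ρ) * (b * SI ω + 1)} ∪ {ω | S₁ ω * S₂ ω < c / ρ} := by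
      intro ω hω
      rcases lt_or_ge (X ρ ω) M with hlt | hge
      · left
        have h6 := (hX ρ hρ ω).trans_lt hlt
        have := hSI ω
        rw [div_lt_iff₀ (by positivity)] at h6
        change S₁ ω < _
        rw [div_mul_eq_mul_div, lt_div_iff₀ (by positivity)]
        linarith
      · right
        have h6 := lt_of_twoHopRatio_lt hg hM hge (hY0 ρ hρ ω) hω
        change S₁ ω * S₂ ω < c / ρ
        rw [lt_div_iff₀ hρ, hc, lt_div_iff₀ hk]
        have := mul_nonneg (mul_nonneg (mul_nonneg hk.le he) (hSI ω)) (hS₂ ω)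
        nlinarith
    have hP : P.real {ω | twoHopRatio (X ρ ω) (k * (ρ * S₁ ω + e * SI ω) * S₂ ω) < g}
        ≤ (M / (a * ρ)) ^ (m + 1) / (m + 1).factorial * I.toReal
          + (gammaProdCDF m (c / ρ)).toReal := by
      refine (measureReal_mono hsub).trans ((measureReal_union_le _ _).trans (add_le_add ?_ ?_))
      · have := ENNReal.toReal_mono (by finiteness)
          (h.measure_lt_mul_le hSI hb (by positivity : 0 ≤ M / (a * ρ)))
        rwa [ENNReal.toReal_mul, ENNReal.toReal_ofReal (by positivity)] at this
      · rw [Measure.real, h.measure_mul_lt]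
    calc _ ≤ ((M / (a * ρ)) ^ (m + 1) / (m + 1).factorial * I.toReal
          + (gammaProdCDF m (c / ρ)).toReal) * (ρ ^ (m + 1) / Real.log ρ) := by gcongr
      _ = _ := by
          rw [← div_div M a ρ, div_pow (M / a) ρ]
          field_simp

end OutageAsymptotics

/-! ### The common limit for the relay system -/

lemma IsRayleighFading.hasGammaTripleLaw {Ω : Type*} [MeasurableSpace Ω] {P : Measure Ω}
    [IsProbabilityMeasure P] {m : ℕ} {h₁ hI h₂ : Ω → Fin (m + 1) → ℂ}
    (h : IsRayleighFading P h₁ hI h₂) :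
    HasGammaTripleLaw P m (fun ω => sqNorm (h₁ ω)) (fun ω => sqNorm (hI ω))
      (fun ω => sqNorm (h₂ ω)) := by
  have e : MeasurePreserving (sqNorm : (Fin (m + 1) → ℂ) → ℝ)
      (Measure.pi fun _ => stdComplexGaussian) (gammaMeasure (m + 1 : ℕ) 1) :=
    ⟨measurable_sqNorm, map_sqNorm_pi_stdComplexGaussian m.succ_pos⟩
  exact (e.prod (e.prod e)).comp_hasLaw h.hasLaw

/-- The limit of the outage probability times `ρ₁ ^ N / log ρ₁`. -/
noncomputable def outageConstant (p : RelayParams) (m : ℕ) : ℝ :=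
  (p.γth / (p.η * p.θ / (p.d₁ ^ p.τ * p.d₂ ^ p.τ))) ^ (m + 1) / (m.factorial * (m + 1).factorial)

lemma outageConstant_pos {p : RelayParams} (hp : p.Admissible) (m : ℕ) :
    0 < outageConstant p m := by
  have hd₁ : 0 < p.d₁ ^ p.τ := Real.rpow_pos_of_pos hp.d₁_pos _
  have hd₂ : 0 < p.d₂ ^ p.τ := Real.rpow_pos_of_pos hp.d₂_pos _
  have hη := hp.η_pos
  have hθ0 := hp.θ_pos
  have hγ := hp.γth_pos
  unfold outageConstant
  positivity

lemma tendsto_outage_mul_pow_div_log {Ω : Type*} [MeasurableSpace Ω] {P : Measure Ω}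
    [IsProbabilityMeasure P] {m : ℕ} {p : RelayParams} (hp : p.Admissible)
    {h₁ hI h₂ : Ω → Fin (m + 1) → ℂ} (h : IsRayleighFading P h₁ hI h₂) (X : ℝ → Ω → ℝ)
    (hX : ∀ ρ, 0 < ρ → ∀ ω, mrcRatio ((1 - p.θ) * ρ / p.d₁ ^ p.τ)
      ((1 - p.θ) * p.ρI / p.dI ^ p.τ) (h₁ ω) (hI ω) ≤ X ρ ω) :
    Tendsto (fun ρ : ℝ =>
      P.real {ω | twoHopRatio (X ρ ω) (secondHopSNR p ρ (h₁ ω) (hI ω) (h₂ ω)) < p.γth}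
        * (ρ ^ (m + 1) / Real.log ρ)) atTop (𝓝 (outageConstant p m)) := by
  have hd₁ : 0 < p.d₁ ^ p.τ := Real.rpow_pos_of_pos hp.d₁_pos _
  have hd₂ : 0 < p.d₂ ^ p.τ := Real.rpow_pos_of_pos hp.d₂_pos _
  have hdI : 0 < p.dI ^ p.τ := Real.rpow_pos_of_pos hp.dI_pos _
  have hη := hp.η_pos
  have hθ0 := hp.θ_pos
  have hθ := sub_pos.mpr hp.θ_lt_one
  have hρI := hp.ρI_pos
  have hb : 0 < (1 - p.θ) * p.ρI / p.dI ^ p.τ := by positivity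
  have hY (ρ : ℝ) (ω : Ω) : secondHopSNR p ρ (h₁ ω) (hI ω) (h₂ ω) =
      p.η * p.θ / (p.d₁ ^ p.τ * p.d₂ ^ p.τ) * (ρ * sqNorm (h₁ ω)
        + p.ρI * p.d₁ ^ p.τ / p.dI ^ p.τ * sqNorm (hI ω)) * sqNorm (h₂ ω) := by
    unfold secondHopSNR harvestedPower
    field_simp
  simp_rw [hY]
  refine h.hasGammaTripleLaw.tendsto_outage (fun _ => sqNorm_nonneg _) (fun _ => sqNorm_nonneg _)
    (fun _ => sqNorm_nonneg _) (a := (1 - p.θ) / p.d₁ ^ p.τ) (by positivity) hb.le (by positivity)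
    (by positivity) hp.γth_pos X fun ρ hρ ω => ?_
  refine le_trans (le_of_eq ?_) ((div_le_mrcRatio (a := (1 - p.θ) * ρ / p.d₁ ^ p.τ)
    (by positivity) hb.le (h₁ ω) (hI ω)).trans (hX ρ hρ ω))
  rw [div_mul_eq_mul_div (1 - p.θ)]

/-- The limit does not depend on `a`: its term is constant inside the bracket and vanishes after
division by `log ρ`, while the hypergeometric sum contributes `1`. -/
lemma tendsto_highSNRApprox_mul_pow_div_log {p : RelayParams} (hp : p.Admissible) (m : ℕ) (a : ℝ) :
    Tendsto (fun ρ : ℝ => highSNRApprox p (m + 1) a ρ * (ρ ^ (m + 1) / Real.log ρ)) atTop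
      (𝓝 (outageConstant p m)) := by
  have hd₁ : 0 < p.d₁ ^ p.τ := Real.rpow_pos_of_pos hp.d₁_pos _
  have hd₂ : 0 < p.d₂ ^ p.τ := Real.rpow_pos_of_pos hp.d₂_pos _
  have hdI : 0 < p.dI ^ p.τ := Real.rpow_pos_of_pos hp.dI_pos _
  have hη := hp.η_pos
  have hθ0 := hp.θ_pos
  have hρI := hp.ρI_pos
  set κ := p.d₁ ^ p.τ * p.ρI / p.dI ^ p.τ with hκ
  have hκpos : 0 < κ := by positivity
  set C := (p.d₂ ^ p.τ / (p.η * p.θ)) ^ (m + 1) / ((m + 1).factorial * m.factorial) with hC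
  set A := a * (1 / (1 - p.θ) ^ (m + 1)) with hA
  have h1 : Tendsto (fun ρ : ℝ => (p.d₁ ^ p.τ * p.γth) ^ (m + 1) * (A / Real.log ρ +
      C * (hypergeometricSum (m + 1) (1 - κ / ρ) / Real.log ρ))) atTop
      (𝓝 ((p.d₁ ^ p.τ * p.γth) ^ (m + 1) * (0 + C * 1))) :=
    (((tendsto_const_nhds).div_atTop Real.tendsto_log_atTop).add
      ((tendsto_hypergeometricSum_div_log m.succ_pos hκpos).const_mul C)).const_mul _
  have h2 : (p.d₁ ^ p.τ * p.γth) ^ (m + 1) * (0 + C * 1) = outageConstant p m := by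
    rw [hC, outageConstant]
    simp only [div_pow, mul_pow]
    field_simp
    ring
  rw [← h2]
  refine h1.congr' ?_
  filter_upwards [eventually_gt_atTop 1] with ρ hρ
  have hρ0 : 0 < ρ := one_pos.trans hρ
  have hlog := Real.log_pos hρ
  have h3 : p.d₁ ^ p.τ * p.ρI / (p.dI ^ p.τ * ρ) = κ / ρ := by rw [hκ, div_div]
  have h4 : highSNRApprox p (m + 1) a ρ = (p.d₁ ^ p.τ * p.γth / ρ) ^ (m + 1) *
      (A + C * hypergeometricSum (m + 1) (1 - κ / ρ)) := by
    rw [highSNRApprox, h3, hypergeometricSum, Real.Gamma_nat_eq_factorial, hC,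
      show ((m + 1 : ℕ) : ℝ) = (m : ℝ) + 1 by push_cast; rfl, Real.Gamma_nat_eq_factorial]
  rw [h4, div_pow _ ρ]
  field_simp

lemma isEquivalent_of_tendsto_mul {u v φ : ℝ → ℝ} {L : ℝ} (hL : L ≠ 0)
    (hu : Tendsto (fun x => u x * φ x) atTop (𝓝 L)) (hv : Tendsto (fun x => v x * φ x) atTop (𝓝 L)) :
    u ~[atTop] v := by
  have hne := hv.eventually_ne hL
  refine (isEquivalent_iff_tendsto_one (hne.mono fun x hx h => hx (by rw [h, zero_mul]))).mpr ?_
  have h := hu.div hv hL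
  rw [div_self hL] at h
  refine h.congr' (hne.mono fun x hx => ?_)
  exact mul_div_mul_right _ _ (right_ne_zero_of_mul hx)

/-- Take logarithms: the correction `log (log ρ)` is negligible beside `log ρ`, so the logarithmic
factor does not alter the order. -/
lemma tendsto_neg_log_div_log {u : ℝ → ℝ} {N : ℕ} {L : ℝ} (hL : 0 < L)
    (hu : Tendsto (fun ρ => u ρ * (ρ ^ N / Real.log ρ)) atTop (𝓝 L)) :
    Tendsto (fun ρ => -Real.log (u ρ) / Real.log ρ) atTop (𝓝 (N : ℝ)) := by
  have h1 : Tendsto (fun ρ : ℝ => Real.log (u ρ * (ρ ^ N / Real.log ρ)) / Real.log ρ) atTop (𝓝 0) :=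
    ((Real.continuousAt_log hL.ne').tendsto.comp hu).div_atTop Real.tendsto_log_atTop
  have h2 : Tendsto (fun ρ : ℝ => Real.log (Real.log ρ) / Real.log ρ) atTop (𝓝 0) :=
    (Real.isLittleO_log_id_atTop.tendsto_div_nhds_zero).comp Real.tendsto_log_atTop
  have h3 := (h2.neg.add h1.neg).const_add (N : ℝ)
  have h4 : (N : ℝ) + (-0 + -0) = N := by ring
  rw [h4] at h3
  refine h3.congr' ?_
  filter_upwards [eventually_gt_atTop 1, (tendsto_order.1 hu).1 0 hL] with ρ hρ hpos
  have hρ0 : 0 < ρ := one_pos.trans hρ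
  have hlog := Real.log_pos hρ
  have hu0 : u ρ ≠ 0 := left_ne_zero_of_mul hpos.ne'
  rw [Real.log_mul hu0 (by positivity), Real.log_div (by positivity) hlog.ne', Real.log_pow]
  field_simp
  ring

/-! ### Comparison of the array gain coefficients -/

/-- These are the first two terms of the MRC sum, whose remaining terms are positive and exist once
there are two antennas. -/
lemma mmseCoeff_eq_sum (p : RelayParams) (m : ℕ) : mmseCoeff p (m + 1) =
    ∑ n ∈ Finset.range 2, ((1 - p.θ) * p.ρI) ^ n / ((p.dI ^ p.τ) ^ n
      * ((m + 1 - n).factorial : ℝ)) := by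
  rw [mmseCoeff, show ((m + 1 : ℕ) : ℝ) = (m : ℝ) + 1 by push_cast; rfl,
    Real.Gamma_nat_eq_factorial]
  simp [Finset.sum_range_succ]

lemma mmseCoeff_le_mrcCoeff {p : RelayParams} (hp : p.Admissible) (m : ℕ) :
    mmseCoeff p (m + 1) ≤ mrcCoeff p (m + 1) := by
  have hdI : 0 < p.dI ^ p.τ := Real.rpow_pos_of_pos hp.dI_pos _
  have hθ := sub_pos.mpr hp.θ_lt_one
  have hρI := hp.ρI_pos
  rw [mmseCoeff_eq_sum, mrcCoeff]
  exact Finset.sum_le_sum_of_subset_of_nonneg (Finset.range_mono (by omega))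
    fun n _ _ => by positivity

lemma mmseCoeff_lt_mrcCoeff {p : RelayParams} (hp : p.Admissible) {m : ℕ} (hm : 1 ≤ m) :
    mmseCoeff p (m + 1) < mrcCoeff p (m + 1) := by
  have hdI : 0 < p.dI ^ p.τ := Real.rpow_pos_of_pos hp.dI_pos _
  have hθ := sub_pos.mpr hp.θ_lt_one
  have hρI := hp.ρI_pos
  rw [mmseCoeff_eq_sum, mrcCoeff]
  exact Finset.sum_lt_sum_of_subset (i := 2) (Finset.range_mono (by omega)) (by simp; omega)
    (by simp) (by positivity) fun n _ _ => by positivity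

/-! ### Strict inequality of the outage probabilities -/

section StrictInequality
variable {N : ℕ}

lemma continuous_mmseRatio (a : ℝ) {b : ℝ} (hb : 0 ≤ b) :
    Continuous fun q : (Fin N → ℂ) × (Fin N → ℂ) × (Fin N → ℂ) => mmseRatio a b q.1 q.2.1 := by
  unfold mmseRatio
  have h (q : (Fin N → ℂ) × (Fin N → ℂ) × (Fin N → ℂ)) : 1 + b * sqNorm q.2.1 ≠ 0 := by
    have := sqNorm_nonneg q.2.1
    positivity
  have h1 : Continuous fun q : (Fin N → ℂ) × (Fin N → ℂ) × (Fin N → ℂ) => sqNorm q.1 :=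
    continuous_sqNorm.comp continuous_fst
  have h2 : Continuous fun q : (Fin N → ℂ) × (Fin N → ℂ) × (Fin N → ℂ) => sqNorm q.2.1 :=
    continuous_sqNorm.comp (continuous_fst.comp continuous_snd)
  have h3 : Continuous fun q : (Fin N → ℂ) × (Fin N → ℂ) × (Fin N → ℂ) => star q.2.1 ⬝ᵥ q.1 := by
    unfold dotProduct; fun_prop
  fun_prop (disch := exact h _)

lemma continuous_secondHopSNR (p : RelayParams) (ρ₁ : ℝ) :
    Continuous fun q : (Fin N → ℂ) × (Fin N → ℂ) × (Fin N → ℂ) =>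
      secondHopSNR p ρ₁ q.1 q.2.1 q.2.2 := by
  unfold secondHopSNR harvestedPower sqNorm
  fun_prop

/-- Channels at which, by polynomial inequalities, only the MRC/MRT scheme is in outage. -/
def separatingChannels (p : RelayParams) (a b ρ₁ : ℝ) :
    Set ((Fin N → ℂ) × (Fin N → ℂ) × (Fin N → ℂ)) :=
  {q | a * sqNorm q.1 ^ 2 < p.γth * (b * ‖star q.2.1 ⬝ᵥ q.1‖ ^ 2 + sqNorm q.1)} ∩
  {q | p.γth * (mmseRatio a b q.1 q.2.1 + secondHopSNR p ρ₁ q.1 q.2.1 q.2.2 + 1)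
    < mmseRatio a b q.1 q.2.1 * secondHopSNR p ρ₁ q.1 q.2.1 q.2.2}

lemma isOpen_separatingChannels (p : RelayParams) (a : ℝ) {b : ℝ} (hb : 0 ≤ b) (ρ₁ : ℝ) :
    IsOpen (separatingChannels (N := N) p a b ρ₁) := by
  have h1 := continuous_mmseRatio (N := N) a hb
  have h2 := continuous_secondHopSNR (N := N) p ρ₁
  have h3 : Continuous fun q : (Fin N → ℂ) × (Fin N → ℂ) × (Fin N → ℂ) => sqNorm q.1 :=
    continuous_sqNorm.comp continuous_fst
  have h4 : Continuous fun q : (Fin N → ℂ) × (Fin N → ℂ) × (Fin N → ℂ) => star q.2.1 ⬝ᵥ q.1 := by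
    unfold dotProduct; fun_prop
  exact (isOpen_lt (by fun_prop) (by fun_prop)).inter (isOpen_lt (by fun_prop) (by fun_prop))

lemma nonempty_separatingChannels {p : RelayParams} (hp : p.Admissible) {a b ρ₁ : ℝ} (ha : 0 < a)
    (hb : 0 < b) (hρ : 0 < ρ₁) (hN : 2 ≤ N) :
    (separatingChannels (N := N) p a b ρ₁).Nonempty := by
  have hd₁ : 0 < p.d₁ ^ p.τ := Real.rpow_pos_of_pos hp.d₁_pos _
  have hd₂ : 0 < p.d₂ ^ p.τ := Real.rpow_pos_of_pos hp.d₂_pos _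
  have hdI : 0 < p.dI ^ p.τ := Real.rpow_pos_of_pos hp.dI_pos _
  have hη := hp.η_pos
  have hθ0 := hp.θ_pos
  have hρI := hp.ρI_pos
  set g := p.γth with hgdef
  have hg : 0 < g := hp.γth_pos
  let i : Fin N := ⟨0, by omega⟩
  let j : Fin N := ⟨1, by omega⟩
  have hij : i ≠ j := by simp [i, j]
  -- The source channel `t e_i` and the interferer channel `u (e_i + e_j)` are neither parallel nor
  -- orthogonal. MMSE loses at most half of `a t²`, so `a t² = 2 (g + 1)` leaves at least `g + 1`.
  -- The choice `g b u² = a t²` pushes the MRC ratio below `g`.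
  set t := √(2 * (g + 1) / a) with ht
  set u := √(2 * (g + 1) / (g * b)) with hu
  have ht2 : t ^ 2 = 2 * (g + 1) / a := Real.sq_sqrt (by positivity)
  have hu2 : u ^ 2 = 2 * (g + 1) / (g * b) := Real.sq_sqrt (by positivity)
  have ht0 : 0 < t ^ 2 := by rw [ht2]; positivity
  have hsingle (k : Fin N) (r : ℝ) : sqNorm (Pi.single k (r : ℂ)) = r ^ 2 := by
    rw [sqNorm, Finset.sum_eq_single k]
    · simp
    · intro l _ hl; simp [hl]
    · simp
  set x : Fin N → ℂ := Pi.single i (t : ℂ) with hx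
  set y : Fin N → ℂ := Pi.single i (u : ℂ) + Pi.single j (u : ℂ) with hy
  have hSx : sqNorm x = t ^ 2 := hsingle i t
  have hSy : sqNorm y = 2 * u ^ 2 := by
    have : star y ⬝ᵥ y = ((2 * u ^ 2 : ℝ) : ℂ) := by
      rw [hy]
      simp [dotProduct_add, hij, hij.symm]
      ring
    rw [star_dotProduct_self] at this
    exact_mod_cast this
  have hXy : ‖star y ⬝ᵥ x‖ ^ 2 = u ^ 2 * t ^ 2 := by
    rw [hy, hx]
    simp [hij, mul_pow]
  have hM : g + 1 ≤ mmseRatio a b x y := by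
    rw [mmseRatio, hSx, hSy, hXy]
    have : b * (u ^ 2 * t ^ 2) / (1 + b * (2 * u ^ 2)) ≤ t ^ 2 / 2 := by
      rw [div_le_div_iff₀ (by positivity) two_pos]
      nlinarith
    calc g + 1 = a * (t ^ 2 - t ^ 2 / 2) := by rw [ht2]; field_simp; ring
      _ ≤ _ := by gcongr
  set M := mmseRatio a b x y with hMdef
  have hMg : 0 < M - g := by linarith
  set H := harvestedPower p ρ₁ x y with hH
  have hHpos : 0 < H := by
    rw [hH, harvestedPower, hSx, hSy]
    positivity
  -- For first-hop ratio `M > g`, the two-hop ratio exceeds `g` exactly when the second-hop ratio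
  -- exceeds `g (M + 1) / (M - g)`. Scaling `h₂` attains the value `Y`.
  set Y := g * (M + 1) / (M - g) + 1 with hYdef
  have hM0 : 0 < M := by linarith
  have hYpos : 0 < Y := by positivity
  refine ⟨(x, y, Pi.single i ((√(Y * p.d₂ ^ p.τ / H) : ℝ) : ℂ)), ?_, ?_⟩
  · change a * sqNorm x ^ 2 < g * (b * ‖star y ⬝ᵥ x‖ ^ 2 + sqNorm x)
    rw [hSx, hXy]
    have e1 : a * (t ^ 2) ^ 2 = t ^ 2 * (2 * (g + 1)) := by
      rw [sq (t ^ 2)]; nth_rw 2 [ht2]; field_simp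
    have e2 : g * (b * (u ^ 2 * t ^ 2) + t ^ 2) = t ^ 2 * (2 * (g + 1)) + g * t ^ 2 := by
      rw [hu2]; field_simp
    rw [e1, e2]
    linarith [mul_pos hg ht0]
  · change g * (M + secondHopSNR p ρ₁ x y _ + 1) < M * secondHopSNR p ρ₁ x y _
    have e : secondHopSNR p ρ₁ x y (Pi.single i ((√(Y * p.d₂ ^ p.τ / H) : ℝ) : ℂ)) = Y := by
      rw [secondHopSNR, hsingle, Real.sq_sqrt (by positivity), ← hH]
      field_simp
    rw [e]
    have : (M - g) * Y = g * (M + 1) + (M - g) := by rw [hYdef]; field_simp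
    linarith

/-- The MRC outage event contains the MMSE outage event and, disjoint from it, the preimage of the
separating channels, which has positive probability because the joint Gaussian law charges nonempty
open sets. -/
lemma mmseOutage_lt_mrcOutage {Ω : Type*} [MeasurableSpace Ω] {P : Measure Ω}
    [IsProbabilityMeasure P] (hN : 2 ≤ N) {p : RelayParams} (hp : p.Admissible)
    {h₁ hI h₂ : Ω → Fin N → ℂ} (h : IsRayleighFading P h₁ hI h₂) {ρ₁ : ℝ} (hρ : 0 < ρ₁) :
    mmseOutage P p h₁ hI h₂ ρ₁ < mrcOutage P p h₁ hI h₂ ρ₁ := by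
  have hd₁ : 0 < p.d₁ ^ p.τ := Real.rpow_pos_of_pos hp.d₁_pos _
  have hdI : 0 < p.dI ^ p.τ := Real.rpow_pos_of_pos hp.dI_pos _
  have hθ := sub_pos.mpr hp.θ_lt_one
  have hρI := hp.ρI_pos
  unfold mmseOutage mrcOutage
  simp_rw [mmseSINR_eq p hp hρ, mrcSINR_eq p hp hρ]
  set a := (1 - p.θ) * ρ₁ / p.d₁ ^ p.τ with ha
  set b := (1 - p.θ) * p.ρI / p.dI ^ p.τ with hb
  have hapos : 0 < a := by positivity
  have hbpos : 0 < b := by positivity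
  have hmrc0 (x y : Fin N → ℂ) : 0 ≤ mrcRatio a b x y := by
    have := sqNorm_nonneg x
    unfold mrcRatio; positivity
  set A := {ω | twoHopRatio (mmseRatio a b (h₁ ω) (hI ω))
    (secondHopSNR p ρ₁ (h₁ ω) (hI ω) (h₂ ω)) < p.γth} with hA
  set C := {ω | twoHopRatio (mrcRatio a b (h₁ ω) (hI ω))
    (secondHopSNR p ρ₁ (h₁ ω) (hI ω) (h₂ ω)) < p.γth} with hC
  set U := separatingChannels (N := N) p a b ρ₁ with hU
  have hUo : IsOpen U := isOpen_separatingChannels p a hbpos.le ρ₁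
  set E := (fun ω => (h₁ ω, hI ω, h₂ ω)) ⁻¹' U with hE
  have hPE : P E ≠ 0 := by
    have hlaw := h.hasLaw
    rw [hE, ← Measure.map_apply_of_aemeasurable hlaw.aemeasurable hUo.measurableSet, hlaw.map_eq]
    have hpi : (Measure.pi fun _ : Fin N => stdComplexGaussian).IsOpenPosMeasure := inferInstance
    have hprod : ((Measure.pi fun _ : Fin N => stdComplexGaussian).prod
      (Measure.pi fun _ : Fin N => stdComplexGaussian)).IsOpenPosMeasure := inferInstance
    exact (hUo.measure_pos _ (nonempty_separatingChannels hp hapos hbpos hρ hN)).ne'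
  have hEm : NullMeasurableSet E P := h.hasLaw.aemeasurable.nullMeasurableSet_preimage hUo.measurableSet
  have hY (ω : Ω) := secondHopSNR_nonneg p hp hρ (h₁ ω) (hI ω) (h₂ ω)
  have hdisj : Disjoint A E := by
    rw [Set.disjoint_left]
    rintro ω hω ⟨-, hω2⟩
    have h1 : p.γth * (mmseRatio a b (h₁ ω) (hI ω) + secondHopSNR p ρ₁ (h₁ ω) (hI ω) (h₂ ω) + 1)
      < mmseRatio a b (h₁ ω) (hI ω) * secondHopSNR p ρ₁ (h₁ ω) (hI ω) (h₂ ω) := hω2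
    have h2 := (hmrc0 (h₁ ω) (hI ω)).trans (mrcRatio_le_mmseRatio hapos.le hbpos.le _ _)
    have h3 : twoHopRatio _ _ < p.γth := hω
    rw [twoHopRatio, div_lt_iff₀ (by linarith [hY ω])] at h3
    linarith
  have hAC : A ⊆ C := fun ω hω => lt_of_le_of_lt (twoHopRatio_mono (hmrc0 _ _) (hY ω)
    (mrcRatio_le_mmseRatio hapos.le hbpos.le _ _)) hω
  have hEC : E ⊆ C := by
    rintro ω ⟨hω1, -⟩
    have h1 : a * sqNorm (h₁ ω) ^ 2
      < p.γth * (b * ‖star (hI ω) ⬝ᵥ h₁ ω‖ ^ 2 + sqNorm (h₁ ω)) := hω1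
    refine lt_of_le_of_lt (twoHopRatio_le_left (hmrc0 _ _) (hY ω)) ?_
    have h2 : 0 < b * ‖star (hI ω) ⬝ᵥ h₁ ω‖ ^ 2 + sqNorm (h₁ ω) :=
      pos_of_mul_pos_right (lt_of_le_of_lt (by positivity) h1) hp.γth_pos.le
    rwa [mrcRatio, div_lt_iff₀ h2]
  refine (ENNReal.toReal_lt_toReal (measure_ne_top _ _) (measure_ne_top _ _)).mpr ?_
  calc P A < P A + P E := ENNReal.lt_add_right (measure_ne_top _ _) hPE
    _ = P (A ∪ E) := (measure_union₀ hEm hdisj.aedisjoint).symm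
    _ ≤ P C := measure_mono (Set.union_subset hAC hEC)

end StrictInequality

theorem theorem11 {Ω : Type*} [MeasurableSpace Ω] (P : Measure Ω) [IsProbabilityMeasure P]
    (N : ℕ) (hN : 0 < N) (p : RelayParams) (hp : p.Admissible)
    (h₁ hI h₂ : Ω → Fin N → ℂ) (hfading : IsRayleighFading P h₁ hI h₂) :
    -- the high-SNR approximation of the MMSE/MRT outage probability
    (mmseOutage P p h₁ hI h₂) ~[atTop] (highSNRApprox p N (mmseCoeff p N)) ∧
    -- the diversity order of the MMSE/MRT scheme is `N`
    Tendsto (fun ρ₁ : ℝ => -Real.log (mmseOutage P p h₁ hI h₂ ρ₁) / Real.log ρ₁)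
      atTop (𝓝 (N : ℝ)) ∧
    -- the MRC/MRT scheme obeys the same law with its own coefficient, which is not smaller, and
    -- for at least two antennas strictly larger, as is then the MRC/MRT outage probability
    (mrcOutage P p h₁ hI h₂) ~[atTop] (highSNRApprox p N (mrcCoeff p N)) ∧
    mmseCoeff p N ≤ mrcCoeff p N ∧
    (2 ≤ N → mmseCoeff p N < mrcCoeff p N ∧
      ∀ ρ₁ : ℝ, 0 < ρ₁ → mmseOutage P p h₁ hI h₂ ρ₁ < mrcOutage P p h₁ hI h₂ ρ₁) := by
  obtain ⟨m, rfl⟩ := Nat.exists_eq_add_one.mpr hN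
  have hd₁ : 0 < p.d₁ ^ p.τ := Real.rpow_pos_of_pos hp.d₁_pos _
  have hdI : 0 < p.dI ^ p.τ := Real.rpow_pos_of_pos hp.dI_pos _
  have hθ := sub_pos.mpr hp.θ_lt_one
  have hρI := hp.ρI_pos
  have hL := outageConstant_pos hp m
  have hmmse : Tendsto (fun ρ : ℝ => mmseOutage P p h₁ hI h₂ ρ * (ρ ^ (m + 1) / Real.log ρ)) atTop
      (𝓝 (outageConstant p m)) := by
    refine (tendsto_outage_mul_pow_div_log hp hfading
      (fun ρ ω => mmseRatio ((1 - p.θ) * ρ / p.d₁ ^ p.τ) ((1 - p.θ) * p.ρI / p.dI ^ p.τ)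
        (h₁ ω) (hI ω))
      fun ρ hρ ω => mrcRatio_le_mmseRatio (by positivity) (by positivity) _ _).congr' ?_
    filter_upwards [eventually_gt_atTop 0] with ρ hρ
    simp_rw [mmseOutage, mmseSINR_eq p hp hρ]
  have hmrc : Tendsto (fun ρ : ℝ => mrcOutage P p h₁ hI h₂ ρ * (ρ ^ (m + 1) / Real.log ρ)) atTop
      (𝓝 (outageConstant p m)) := by
    refine (tendsto_outage_mul_pow_div_log hp hfading
      (fun ρ ω => mrcRatio ((1 - p.θ) * ρ / p.d₁ ^ p.τ) ((1 - p.θ) * p.ρI / p.dI ^ p.τ)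
        (h₁ ω) (hI ω)) fun ρ hρ ω => le_rfl).congr' ?_
    filter_upwards [eventually_gt_atTop 0] with ρ hρ
    simp_rw [mrcOutage, mrcSINR_eq p hp hρ]
  exact ⟨isEquivalent_of_tendsto_mul hL.ne' hmmse (tendsto_highSNRApprox_mul_pow_div_log hp m _),
    tendsto_neg_log_div_log hL hmmse,
    isEquivalent_of_tendsto_mul hL.ne' hmrc (tendsto_highSNRApprox_mul_pow_div_log hp m _),
    mmseCoeff_le_mrcCoeff hp m,
    fun h2 => ⟨mmseCoeff_lt_mrcCoeff hp (by omega),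
      fun ρ₁ hρ => mmseOutage_lt_mrcOutage h2 hp hfading hρ⟩⟩
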